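/- Let $I\subseteq\mathbb R$ be an interval with more than one point, let $N\ge 1$, and let $\widetilde{\mathsf A}(t')$ be an $N\times N$ matrix whose entries are smooth complex functions of $t'\in I$ (one-sided derivatives being used at an endpoint that belongs to $I$). Let $\mathsf U(t',t)$ ($t\le t'$ in $I$) be its time-ordered exponential, i.e. the solution of $\frac{d}{dt'}\mathsf U(t',t)=\widetilde{\mathsf A}(t')\,\mathsf U(t',t)$, $\mathsf U(t,t)=\mathsf{Id}$. Let $\boldsymbol w,\boldsymbol v\in\mathbb C^N$ be constant vectors with $\boldsymbol w^H\boldsymbol v=1$. *Notation.* $\Theta=\Theta(t'-t)$ is the Heaviside function with $\Theta(0)=1$, $\delta^{(j)}=\delta^{(j)}(t'-t)$ is the $j$th derivative of the Dirac distribution $\delta$, and $\mathrm{Sm}_\Theta$ is the set of distributions $f(t',t)=\widetilde f(t',t)\,\Theta(t'-t)$ with $\widetilde f$ smooth on $I\times I$. Distributions in $(t',t)$ act on test functions $\varphi$ (smooth on $I$ and zero near the left end of $I$) by $\varphi\mapsto\int d(\cdot,t)\varphi(t)\,dt$, and they are multiplied by the $\ast$-product $(f_2\ast f_1)(t',t)=\int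 f_2(t',\tau)f_1(\tau,t)\,d\tau$, that is, by composition of these actions; its unit is $1_\ast=\delta$. On $\mathrm{Sm}_\Theta$ it is $\Theta(t'-t)\int_t^{t'}\widetilde f_2(t',\tau)\widetilde f_1(\tau,t)\,d\tau$. The product extends to matrices of distributions, $\mathsf M^{\ast n}$ denotes powers (with $\mathsf M^{\ast 0}=\mathsf{Id}\,1_\ast$), and $\mathsf R_\ast(\mathsf M)=(\mathsf{Id}\,1_\ast-\mathsf M)^{\ast-1}$ is the $\ast$-resolvent. For smooth $\widetilde f$, $\widetilde f^{(1,0)}$ and $\widetilde f^{(0,1)}$ are the derivatives with respect to $t'$ and $t$. Put $\mathsf A(t',t)=\widetilde{\mathsf A}(t')\Theta(t'-t)$. *Assumption.* For every $t'\in I$, the ordinary non-Hermitian Lanczos algorithm with inputs $\widetilde{\mathsf A}(t'),\boldsymbol w,\boldsymbol v$ has no breakdown in the $k$th iteration, $k=1,\dots,N-1$. That is, with $\mathsf M=\widetilde{\mathsf A}(t')$, $w_{-1}=v_{-1}=0$, $w_0=\boldsymbol w$, $v_0=\boldsymbol v$, $b_0=0$, and, for $k\ge1$, $a_{k-1}=w_{k-1}^H\mathsf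 Mv_{k-1}$, $w_k^H=w_{k-1}^H\mathsf M-a_{k-1}w_{k-1}^H-b_{k-1}w_{k-2}^H$, $\widehat v_k=\mathsf Mv_{k-1}-a_{k-1}v_{k-1}-v_{k-2}$, $b_k=w_k^H\widehat v_k$, $v_k=\widehat v_k/b_k$, one has $b_k\neq0$ for $k=1,\dots,N-1$. *Conclusion.* There are functions $\widetilde\alpha_0,\dots,\widetilde\alpha_{N-1},\widetilde\beta_1,\dots,\widetilde\beta_{N-1}$, smooth on $I\times I$, such that, with $\alpha_j=\widetilde\alpha_j\Theta$ and $\beta_i=\widetilde\beta_i\Theta$ in $\mathrm{Sm}_\Theta$: 1. for $1\le i\le N-1$: $\widetilde\beta_i(t,t)=0$ for all $t\in I$, and neither $\widetilde\beta_i^{(1,0)}(t,t)$ nor $\widetilde\beta_i^{(0,1)}(t,t)$ is identically zero on $I$; 2. the $N\times N$ tridiagonal matrix $$\mathsf T=\begin{bmatrix}\alpha_0&\delta&&\\ \beta_1&\alpha_1&\ddots&\\ &\ddots&\ddots&\delta\\ &&\beta_{N-1}&\alpha_{N-1}\end{bmatrix}$$ satisfies $\boldsymbol w^H\mathsf A^{\ast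 n}\boldsymbol v=(\mathsf T^{\ast n})_{1,1}$ for all $n\ge0$; 3. the $\ast$-resolvent $\mathsf R_\ast(\mathsf T)$ exists, $\mathsf R_\ast(\mathsf T)_{1,1}=\sum_{n\ge0}(\mathsf T^{\ast n})_{1,1}$ (pointwise convergence on every test function), and $\boldsymbol w^H\mathsf U(t',t)\boldsymbol v\,\Theta(t'-t)=\Theta(t'-t)\ast\mathsf R_\ast(\mathsf T)_{1,1}(t',t)$; 4. for $1\le i\le N-1$ the two-sided $\ast$-inverse of $\beta_i$ exists and has the form $\beta_i^{\ast-1}=\delta^{(3)}\ast b_i$ with $b_i\in\mathrm{Sm}_\Theta$. -/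

import Mathlib

open scoped ContDiff Matrix

section Distributions

open MeasureTheory Set Filter Topology

/-! Proved helper facts, used to see that the distributions below act on test functions. -/

theorem interior_interval_nonempty (I : Set ℝ) [I.OrdConnected] [Nontrivial I] :
    (interior I).Nonempty := by
  obtain ⟨⟨a, ha⟩, ⟨b, hb⟩, hab⟩ := exists_pair_lt I
  have hab' : a < b := hab
  exact ⟨(a + b) / 2, interior_mono (Set.Icc_subset I ha hb)
    (by rw [interior_Icc]; constructor <;> linarith)⟩

theorem uniqueDiffOn_interval (I : Set ℝ) [I.OrdConnected] [Nontrivial I] :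
    UniqueDiffOn ℝ I :=
  uniqueDiffOn_convex (convex_iff_ordConnected.2 inferInstance) (interior_interval_nonempty I)

theorem hasDerivAt_integral_param {H D : ℝ → ℝ → ℂ} (hH : Continuous (Function.uncurry H))
    (hD : Continuous (Function.uncurry D)) (hd : ∀ x t, HasDerivAt (fun y => H y t) (D x t) x)
    (c x : ℝ) :
    HasDerivAt (fun y => ∫ t in c..y, H y t) (H x x + ∫ t in c..x, D x t) x := by
  have h1 : HasDerivAt (fun y => ∫ t in c..x, H y t) (∫ t in c..x, D x t) x := by
    obtain ⟨M, hM⟩ := ((isCompact_closedBall x 1).prod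
      (isCompact_uIcc (a := c) (b := x))).exists_bound_of_continuousOn hD.continuousOn
    refine (intervalIntegral.hasDerivAt_integral_of_dominated_loc_of_deriv_le
      (s := Metric.closedBall x 1) (bound := fun _ => M)
      (F := fun y t => H y t) (F' := fun y t => D y t)
      (Metric.closedBall_mem_nhds x one_pos) ?_ ?_ ?_ ?_ ?_ ?_).2
    · exact Filter.Eventually.of_forall fun y =>
        (hH.comp (Continuous.prodMk_right y)).aestronglyMeasurable
    · exact (hH.comp (Continuous.prodMk_right x)).intervalIntegrable _ _
    · exact (hD.comp (Continuous.prodMk_right x)).aestronglyMeasurable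
    · refine Filter.Eventually.of_forall fun t ht y hy => hM (y, t) ⟨hy, ?_⟩
      exact Set.uIoc_subset_uIcc ht
    · exact intervalIntegrable_const
    · exact Filter.Eventually.of_forall fun t _ y _ => hd y t
  have h2 : HasDerivAt (fun y => ∫ t in x..y, H y t) (H x x) x := by
    have e : (fun y => ∫ t in x..y, H y t)
        = fun y => (y - x) • ∫ s in (0:ℝ)..1, H y (x + (y - x) * s) := by
      funext y
      have := intervalIntegral.smul_integral_comp_add_mul (a := 0) (b := 1) (H y) (y - x) x
      simp only [mul_zero, add_zero, mul_one, add_sub_cancel] at this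
      exact this.symm
    rw [e, hasDerivAt_iff_tendsto_slope]
    have hc : Continuous fun y => ∫ s in (0:ℝ)..1, H y (x + (y - x) * s) := by
      apply intervalIntegral.continuous_parametric_intervalIntegral_of_continuous'
      exact hH.comp (by fun_prop : Continuous fun p : ℝ × ℝ => (p.1, x + (p.1 - x) * p.2))
    have := (hc.tendsto x).mono_left (nhdsWithin_le_nhds (s := {x}ᶜ))
    simp only [sub_self, zero_mul, add_zero, intervalIntegral.integral_const, sub_zero,
      one_smul] at this
    refine this.congr' ?_
    filter_upwards [self_mem_nhdsWithin] with y hy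
    have : y - x ≠ 0 := sub_ne_zero.2 hy
    simp only [slope, vsub_eq_sub, sub_self, zero_smul, sub_zero]
    rw [smul_smul, inv_mul_cancel₀ this, one_smul]
  have h3 := h2.add h1
  refine h3.congr_of_eventuallyEq (Filter.Eventually.of_forall fun y => ?_)
  have hi : ∀ a b, IntervalIntegrable (H y) volume a b := fun a b =>
    (hH.comp (Continuous.prodMk_right y)).intervalIntegrable _ _
  simp only [Pi.add_apply]
  rw [add_comm, intervalIntegral.integral_add_adjacent_intervals (hi _ _) (hi _ _)]

theorem hasDerivWithinAt_integral_param_Icc {a b : ℝ} (hab : a ≤ b) {h D : ℝ → ℝ → ℂ}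
    (hh : ContinuousOn (Function.uncurry h) (Icc a b ×ˢ Icc a b))
    (hD : ContinuousOn (Function.uncurry D) (Icc a b ×ˢ Icc a b))
    (hd : ∀ x ∈ Icc a b, ∀ t ∈ Icc a b, HasDerivWithinAt (fun y => h y t) (D x t) (Icc a b) x)
    {c x : ℝ} (hc : c ∈ Icc a b) (hx : x ∈ Icc a b) :
    HasDerivWithinAt (fun y => ∫ t in c..y, h y t) (h x x + ∫ t in c..x, D x t) (Icc a b) x := by
  let p : ℝ → ℝ := fun t => (projIcc a b hab t : ℝ)
  have hp : Continuous p := continuous_subtype_val.comp continuous_projIcc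
  have hpm : ∀ t, p t ∈ Icc a b := fun t => (projIcc a b hab t).2
  have hpe : ∀ t ∈ Icc a b, p t = t := fun t ht => by simp [p, projIcc_of_mem hab ht]
  let D' : ℝ → ℝ → ℂ := fun s t => D (p s) (p t)
  have hD' : Continuous (Function.uncurry D') :=
    hD.comp_continuous (f := fun q : ℝ × ℝ => (p q.1, p q.2)) (by fun_prop)
      fun q => ⟨hpm _, hpm _⟩
  let H : ℝ → ℝ → ℂ := fun x t => h a (p t) + ∫ s in a..x, D' s t
  have hH : Continuous (Function.uncurry H) := by
    have h1 : Continuous fun q : ℝ × ℝ => h a (p q.2) :=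
      hh.comp_continuous (f := fun q : ℝ × ℝ => (a, p q.2)) (by fun_prop)
        fun q => ⟨left_mem_Icc.2 hab, hpm _⟩
    have h2 : Continuous fun q : ℝ × ℝ => ∫ s in a..q.1, D' s q.2 := by
      apply intervalIntegral.continuous_parametric_intervalIntegral_of_continuous
        (f := fun (q : ℝ × ℝ) s => D' s q.2) (s := fun q => q.1)
      · exact hD'.comp (by fun_prop : Continuous fun r : (ℝ × ℝ) × ℝ => (r.2, r.1.2))
      · fun_prop
    exact h1.add h2
  have hHd : ∀ x t, HasDerivAt (fun y => H y t) (D' x t) x := by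
    intro x t
    refine HasDerivAt.const_add _ ?_
    exact (hD'.comp (Continuous.prodMk_left t)).integral_hasStrictDerivAt a x |>.hasDerivAt
  have hHe : ∀ x ∈ Icc a b, ∀ t ∈ Icc a b, h x t = H x t := by
    intro x hx t ht
    have := intervalIntegral.integral_eq_sub_of_hasDeriv_right_of_le (a := a) (b := x)
      (f := fun y => h y t) (f' := fun s => D' s t) hx.1 ?_ ?_ ?_
    · simp only [H, this, hpe t ht]; ring
    · exact hh.comp (f := fun y => (y, t)) (by fun_prop)
        fun y hy => ⟨⟨hy.1, hy.2.trans hx.2⟩, ht⟩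
    · intro y hy
      have hy' : y ∈ Icc a b := ⟨hy.1.le, hy.2.le.trans hx.2⟩
      have h1 := hd y hy' t ht
      simp only [D', hpe y hy', hpe t ht]
      refine h1.mono_of_mem_nhdsWithin ?_
      have : Icc a b ∈ 𝓝 y := Icc_mem_nhds hy.1 (hy.2.trans_le hx.2)
      exact nhdsWithin_le_nhds this
    · exact (hD'.comp (Continuous.prodMk_left t)).intervalIntegrable _ _
  have key := (hasDerivAt_integral_param hH hD' hHd c x).hasDerivWithinAt (s := Icc a b)
  have e1 : ∫ t in c..x, D x t = ∫ t in c..x, D' x t := by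
    refine intervalIntegral.integral_congr fun t ht => ?_
    have ht' : t ∈ Icc a b := (Set.OrdConnected.uIcc_subset inferInstance hc hx) ht
    simp only [D', hpe x hx, hpe t ht']
  rw [e1, hHe x hx x hx]
  refine key.congr (fun y hy => ?_) ?_
  · refine intervalIntegral.integral_congr fun t ht => ?_
    exact hHe y hy t ((Set.OrdConnected.uIcc_subset inferInstance hc hy) ht)
  · refine intervalIntegral.integral_congr fun t ht => ?_
    exact hHe x hx t ((Set.OrdConnected.uIcc_subset inferInstance hc hx) ht)

theorem exists_Icc_mem_nhdsWithin (I : Set ℝ) [I.OrdConnected] {c x : ℝ}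
    (hc : c ∈ I) (hx : x ∈ I) :
    ∃ a ∈ I, ∃ b ∈ I, a ≤ b ∧ c ∈ Icc a b ∧ x ∈ Icc a b ∧ Icc a b ∈ 𝓝[I] x := by
  have hl : ∃ a ∈ I, a ≤ c ∧ a ≤ x ∧ ∀ᶠ y in 𝓝[I] x, a ≤ y := by
    by_cases h : ∃ a ∈ I, a < x
    · obtain ⟨a, ha, hax⟩ := h
      refine ⟨min a c, by rcases min_choice a c with h | h <;> rw [h] <;> assumption,
        min_le_right _ _, (min_le_left _ _).trans hax.le, ?_⟩
      filter_upwards [nhdsWithin_le_nhds (Ioi_mem_nhds hax)] with y hy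
      exact (min_le_left _ _).trans (le_of_lt hy)
    · push Not at h
      exact ⟨x, hx, h c hc, le_rfl, by filter_upwards [self_mem_nhdsWithin] with y hy using h y hy⟩
  have hr : ∃ a ∈ I, c ≤ a ∧ x ≤ a ∧ ∀ᶠ y in 𝓝[I] x, y ≤ a := by
    by_cases h : ∃ a ∈ I, x < a
    · obtain ⟨a, ha, hax⟩ := h
      refine ⟨max a c, by rcases max_choice a c with h | h <;> rw [h] <;> assumption,
        le_max_right _ _, hax.le.trans (le_max_left _ _), ?_⟩
      filter_upwards [nhdsWithin_le_nhds (Iio_mem_nhds hax)] with y hy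
      exact (le_of_lt hy).trans (le_max_left _ _)
    · push Not at h
      exact ⟨x, hx, h c hc, le_rfl, by filter_upwards [self_mem_nhdsWithin] with y hy using h y hy⟩
  obtain ⟨a, ha, h1, h2, h3⟩ := hl
  obtain ⟨b, hb, h4, h5, h6⟩ := hr
  exact ⟨a, ha, b, hb, h2.trans h5, ⟨h1, h4⟩, ⟨h2, h5⟩, by filter_upwards [h3, h6] with y h h' using ⟨h, h'⟩⟩

theorem contDiffOn_integral_param (I : Set ℝ) [I.OrdConnected] [Nontrivial I] {c : ℝ}
    (hc : c ∈ I) (n : ℕ) : ∀ h : ℝ → ℝ → ℂ, ContDiffOn ℝ ∞ (Function.uncurry h) (I ×ˢ I) →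
      ContDiffOn ℝ n (fun x => ∫ t in c..x, h x t) I := by
  have hI := uniqueDiffOn_interval I
  have main : ∀ h : ℝ → ℝ → ℂ, ContDiffOn ℝ ∞ (Function.uncurry h) (I ×ˢ I) →
      ∃ D : ℝ → ℝ → ℂ, ContDiffOn ℝ ∞ (Function.uncurry D) (I ×ˢ I) ∧ ∀ x ∈ I,
        HasDerivWithinAt (fun y => ∫ t in c..y, h y t) (h x x + ∫ t in c..x, D x t) I x := by
    intro h hh
    have hd := (contDiffOn_infty_iff_fderivWithin (hI.prod hI)).1 hh
    refine ⟨fun x t => fderivWithin ℝ (Function.uncurry h) (I ×ˢ I) (x, t) (1, 0), ?_, ?_⟩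
    · exact hd.2.clm_apply contDiffOn_const
    · intro x hx
      obtain ⟨a, ha, b, hb, hab, hc', hx', hn⟩ := exists_Icc_mem_nhdsWithin I hc hx
      have hs : Icc a b ⊆ I := Set.Icc_subset I ha hb
      refine (hasDerivWithinAt_integral_param_Icc hab (h := h)
        (D := fun x t => fderivWithin ℝ (Function.uncurry h) (I ×ˢ I) (x, t) (1, 0))
        (hh.continuousOn.mono (prod_mono hs hs))
        ((hd.2.clm_apply contDiffOn_const).continuousOn.mono (prod_mono hs hs))
        ?_ hc' hx').mono_of_mem_nhdsWithin hn
      intro y hy t ht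
      have h1 := (hd.1 (y, t) ⟨hs hy, hs ht⟩).hasFDerivWithinAt
      have h2 : HasDerivWithinAt (fun z : ℝ => (z, t)) ((1 : ℝ), (0 : ℝ)) (Icc a b) y :=
        (hasDerivWithinAt_id y _).prodMk (hasDerivWithinAt_const y _ t)
      exact h1.comp_hasDerivWithinAt (t := I ×ˢ I) y h2 fun z hz => ⟨hs hz, hs ht⟩
  induction n with
  | zero =>
    intro h hh
    obtain ⟨D, _, hD⟩ := main h hh
    exact contDiffOn_zero.2 fun x hx => (hD x hx).continuousWithinAt
  | succ n ih =>
    intro h hh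
    obtain ⟨D, hDs, hD⟩ := main h hh
    have : ((n + 1 : ℕ) : WithTop ℕ∞) = n + 1 := by push_cast; rfl
    rw [this, contDiffOn_succ_iff_derivWithin hI]
    refine ⟨fun x hx => (hD x hx).differentiableWithinAt, by simp, ?_⟩
    have h1 : ContDiffOn ℝ n (fun x => h x x + ∫ t in c..x, D x t) I := by
      refine ContDiffOn.add ?_ (ih D hDs)
      exact (hh.comp (f := fun x : ℝ => (x, x)) (by fun_prop) fun x hx => ⟨hx, hx⟩).of_le
        (by exact_mod_cast le_top)
    exact h1.congr fun x hx => (hD x hx).derivWithin (hI x hx)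

/-- Test functions on the interval `I`: the complex functions that are smooth on `I` and vanish
near the left end of `I`. They are stored as functions on `ℝ`, extended by zero outside `I`. -/
def TestSpace (I : Set ℝ) [I.OrdConnected] [Nontrivial I] : Submodule ℂ (ℝ → ℂ) where
  carrier := {φ | ContDiffOn ℝ ∞ φ I ∧ (∀ t, t ∉ I → φ t = 0) ∧
    ∃ c ∈ interior I, ∀ t ≤ c, φ t = 0}
  zero_mem' := by
    refine ⟨contDiffOn_const, fun _ _ => rfl, ?_⟩
    obtain ⟨c, hc⟩ := interior_interval_nonempty I
    exact ⟨c, hc, fun _ _ => rfl⟩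
  add_mem' := by
    rintro φ ψ ⟨h1, h2, c, hc, h3⟩ ⟨k1, k2, d, hd, k3⟩
    refine ⟨h1.add k1, fun t ht => by simp [h2 t ht, k2 t ht], min c d, ?_, fun t ht => ?_⟩
    · rcases min_choice c d with h | h <;> rw [h] <;> assumption
    · simp [h3 t (ht.trans (min_le_left _ _)), k3 t (ht.trans (min_le_right _ _))]
  smul_mem' := by
    rintro z φ ⟨h1, h2, c, hc, h3⟩
    exact ⟨contDiffOn_const.smul h1, fun t ht => by simp [h2 t ht], c, hc,
      fun t ht => by simp [h3 t ht]⟩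

/-- A function of two variables `(t', t)` that is smooth on `I × I`. It is the smooth part
of a piecewise smooth distribution, an element of the class `Sm_Θ`. -/
structure SmoothKernel (I : Set ℝ) where
  toFun : ℝ → ℝ → ℂ
  smooth : ContDiffOn ℝ ∞ (Function.uncurry toFun) (I ×ˢ I)

instance (I : Set ℝ) : CoeFun (SmoothKernel I) fun _ => ℝ → ℝ → ℂ := ⟨SmoothKernel.toFun⟩

/-- The algebra in which distributions `d(t', t)` are composed. A distribution
`d(t', t)` in two variables, such as a superposition of `Θ(t' - t)` and of derivatives of
`δ(t' - t)` with smooth coefficients, is given through its action on test functions: for each `t'`,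
the linear functional `φ ↦ ∫ d(t', t) φ(t) dt`. This depends smoothly on `t'`, and vanishes for `t'`
near the left end of `I`, so `d` is a linear endomorphism of the space of test functions.
The `∗`-product `(f₂ ∗ f₁)(t', t) = ∫ f₂(t', τ) f₁(τ, t) dτ` sends `φ` to
`∫ f₂(t', τ) (∫ f₁(τ, t) φ(t) dt) dτ`, so it is the multiplication (that is, the composition) of
`Module.End`; the unit `1` is `1_∗ = δ`, and the powers are the `∗`-powers. Matrices of distributions
form the ring of matrices over this ring. -/
abbrev StarAlgebra (I : Set ℝ) [I.OrdConnected] [Nontrivial I] : Type :=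
  Module.End ℂ (TestSpace I)

theorem kernel_integrand_integrableOn (I : Set ℝ) [I.OrdConnected] [Nontrivial I]
    (f : SmoothKernel I) (φ : TestSpace I) {s : ℝ} (hs : s ∈ I) :
    IntegrableOn (fun t => f s t * (φ : ℝ → ℂ) t) (Iic s) := by
  obtain ⟨φ, h1, h2, c, hc, h3⟩ := φ
  have hcI : c ∈ I := interior_subset hc
  have hci : ContinuousOn (fun t => f s t * φ t) I := by
    refine ContinuousOn.mul ?_ h1.continuousOn
    exact f.smooth.continuousOn.comp (f := fun t => (s, t)) (by fun_prop) fun t ht => ⟨hs, ht⟩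
  have h : IntegrableOn (fun t => f s t * φ t) (Icc c s) :=
    (hci.mono (Set.Icc_subset I hcI hs)).integrableOn_compact isCompact_Icc
  refine IntegrableOn.of_forall_sdiff_eq_zero h measurableSet_Iic fun t ht => ?_
  have : t ≤ c := by
    by_contra hlt
    exact ht.2 ⟨le_of_lt (not_le.1 hlt), ht.1⟩
  simp [h3 t this]

/-- The element `f(t', t) Θ(t' - t)` of `Sm_Θ`, with `Θ(0) = 1`. It acts on a test function `φ` by
`t' ↦ ∫ f(t', t) Θ(t' - t) φ(t) dt`, an integral over `t ≤ t'` (and `t ∈ I`, as `φ` is zero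
elsewhere). -/
noncomputable def SmoothKernel.dist {I : Set ℝ} [I.OrdConnected] [Nontrivial I]
    (f : SmoothKernel I) : StarAlgebra I where
  toFun φ := ⟨I.indicator fun s => ∫ t in Iic s, f s t * (φ : ℝ → ℂ) t, by
    obtain ⟨φ, h1, h2, c, hc, h3⟩ := φ
    have hcI : c ∈ I := interior_subset hc
    refine ⟨?_, fun t ht => indicator_of_notMem ht _, c, hc, fun s hs => ?_⟩
    · have h : ContDiffOn ℝ ∞ (fun s => ∫ t in c..s, f s t * φ t) I :=
        contDiffOn_infty.2 fun n => contDiffOn_integral_param I hcI n _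
          (f.smooth.mul (h1.comp contDiffOn_snd fun p hp => hp.2))
      refine h.congr fun s hs => ?_
      rw [indicator_of_mem hs]
      have hz : ∀ t ≤ c, f s t * φ t = 0 := fun t ht => by simp [h3 t ht]
      rcases le_total c s with hcs | hcs
      · rw [intervalIntegral.integral_of_le hcs]
        refine (setIntegral_eq_of_subset_of_forall_sdiff_eq_zero measurableSet_Iic
          Ioc_subset_Iic_self fun t ht => hz t ?_)
        by_contra hlt
        exact ht.2 ⟨not_le.1 hlt, ht.1⟩
      · have h0 : ∫ t in Iic s, f s t * φ t = 0 :=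
          setIntegral_eq_zero_of_forall_eq_zero fun t ht => hz t (le_trans (mem_Iic.1 ht) hcs)
        refine h0.trans ?_
        rw [intervalIntegral.integral_zero_ae]
        refine Filter.Eventually.of_forall fun t ht => hz t ?_
        rw [uIoc_of_ge hcs] at ht
        exact ht.2
    · by_cases hsI : s ∈ I
      · rw [indicator_of_mem hsI]
        exact setIntegral_eq_zero_of_forall_eq_zero fun t ht => by
          simp [h3 t (le_trans ht hs)]
      · exact indicator_of_notMem hsI _⟩
  map_add' φ ψ := by
    ext s
    by_cases hs : s ∈ I
    · simp only [Submodule.coe_add, Pi.add_apply, indicator_of_mem hs, mul_add]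
      exact integral_add (kernel_integrand_integrableOn I f φ hs)
        (kernel_integrand_integrableOn I f ψ hs)
    · simp [hs]
  map_smul' z φ := by
    ext s
    by_cases hs : s ∈ I
    · simp only [Submodule.coe_smul, Pi.smul_apply, indicator_of_mem hs, smul_eq_mul,
        RingHom.id_apply, mul_left_comm _ z]
      exact integral_const_mul _ _
    · simp [hs]

/-- The distribution `δ^(j)(t' - t)`. It acts on a test function by
`φ ↦ ∫ δ^(j)(t' - t) φ(t) dt = φ^(j)(t')`. -/
noncomputable def deltaDist (I : Set ℝ) [I.OrdConnected] [Nontrivial I] (j : ℕ) :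
    StarAlgebra I where
  toFun φ := ⟨I.indicator (iteratedDerivWithin j (φ : ℝ → ℂ) I), by
    obtain ⟨φ, h1, h2, c, hc, h3⟩ := φ
    have hI := uniqueDiffOn_interval I
    refine ⟨?_, fun t ht => indicator_of_notMem ht _, ?_⟩
    · refine ContDiffOn.congr ?_ fun t ht => indicator_of_mem ht _
      induction j with
      | zero => simpa using h1
      | succ j ih =>
        rw [iteratedDerivWithin_succ]
        exact ((contDiffOn_infty_iff_derivWithin hI).1 ih).2
    · obtain ⟨d, hdc, hd⟩ : ∃ d < c, d ∈ interior I :=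
        by
        obtain ⟨l, u, ⟨hl, hu⟩, hlu⟩ := mem_nhds_iff_exists_Ioo_subset.1
          (isOpen_interior.mem_nhds hc)
        exact ⟨(l + c) / 2, by linarith, hlu ⟨by linarith, by linarith⟩⟩
      refine ⟨d, hd, fun t ht => ?_⟩
      by_cases htI : t ∈ I
      · rw [indicator_of_mem htI]
        have : φ =ᶠ[𝓝[I] t] fun _ => 0 := by
          filter_upwards [nhdsWithin_le_nhds (Iio_mem_nhds (ht.trans_lt hdc))] with s hs
          exact h3 s (le_of_lt hs)
        rw [this.iteratedDerivWithin_eq (h3 t (ht.trans hdc.le))]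
        simp
      · exact indicator_of_notMem htI _⟩
  map_add' φ ψ := by
    ext s
    by_cases hs : s ∈ I
    · simp only [Submodule.coe_add, Pi.add_apply, indicator_of_mem hs]
      exact iteratedDerivWithin_add hs (uniqueDiffOn_interval I)
        ((φ.2.1 s hs).of_le (by exact_mod_cast le_top)) ((ψ.2.1 s hs).of_le (by exact_mod_cast le_top))
    · simp [hs]
  map_smul' z φ := by
    ext s
    by_cases hs : s ∈ I
    · simp only [Submodule.coe_smul, Pi.smul_apply, indicator_of_mem hs, RingHom.id_apply]
      exact iteratedDerivWithin_const_smul hs (uniqueDiffOn_interval I) z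
        ((φ.2.1 s hs).of_le (by exact_mod_cast le_top))
    · simp [hs]

/-- The Heaviside distribution `Θ(t' - t)`. -/
noncomputable def thetaDist (I : Set ℝ) [I.OrdConnected] [Nontrivial I] : StarAlgebra I :=
  SmoothKernel.dist ⟨fun _ _ => 1, contDiffOn_const⟩

/-- `δ` is the unit of the `∗`-product. -/
theorem deltaDist_zero (I : Set ℝ) [I.OrdConnected] [Nontrivial I] : deltaDist I 0 = 1 := by
  ext φ s
  by_cases hs : s ∈ I
  · simp [deltaDist, hs]
  · simp [deltaDist, hs, φ.2.2.1 s hs]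

end Distributions

/-- The matrix of distributions `Ã(t') Θ(t' - t)`, for a matrix `Ã(t')` of smooth functions. -/
noncomputable def matrixTheta {I : Set ℝ} [I.OrdConnected] [Nontrivial I] {N : ℕ}
    (A : ℝ → Matrix (Fin N) (Fin N) ℂ) (hA : ∀ i j, ContDiffOn ℝ ∞ (fun s => A s i j) I) :
    Matrix (Fin N) (Fin N) (StarAlgebra I) :=
  Matrix.of fun i j => SmoothKernel.dist
    ⟨fun s _ => A s i j, (hA i j).comp contDiffOn_fst fun _ hp => hp.1⟩

/-- `w^H M v` for a matrix `M` of distributions and constant vectors `w`, `v`. -/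
noncomputable def sandwich {I : Set ℝ} [I.OrdConnected] [Nontrivial I] {N : ℕ}
    (w : Fin N → ℂ) (M : Matrix (Fin N) (Fin N) (StarAlgebra I)) (v : Fin N → ℂ) :
    StarAlgebra I :=
  ∑ i, ∑ j, (star (w i) * v j) • M i j

/-- The tridiagonal matrix with `α₀ Θ, …, α_{N-1} Θ` on the diagonal, `β₁ Θ, …, β_{N-1} Θ` on the
subdiagonal (`β_i` in row `i`, rows being counted from `0`) and `δ` on the superdiagonal. -/
noncomputable def tridiagonal {I : Set ℝ} [I.OrdConnected] [Nontrivial I] (N : ℕ)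
    (α β : ℕ → SmoothKernel I) : Matrix (Fin N) (Fin N) (StarAlgebra I) :=
  Matrix.of fun i j =>
    if (i : ℕ) = j then (α i).dist
    else if (j : ℕ) = i + 1 then deltaDist I 0
    else if (i : ℕ) = j + 1 then (β i).dist
    else 0

/-- The `∗`-resolvent `R_∗(M) = (Id 1_∗ - M)^{∗-1}` of a matrix of distributions
(`0` by convention if there is no inverse). -/
noncomputable def starResolvent {I : Set ℝ} [I.OrdConnected] [Nontrivial I] {N : ℕ}
    (M : Matrix (Fin N) (Fin N) (StarAlgebra I)) : Matrix (Fin N) (Fin N) (StarAlgebra I) :=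
  Ring.inverse (1 - M)

/-- `U(t', t)` is the time-ordered exponential of `A` on `I`: for each `t ∈ I`,
`U(t, t) = Id` and `d/dt' U(t', t) = A(t') U(t', t)` for all `t' ∈ I` with `t ≤ t'`. -/
def IsTimeOrderedExp (I : Set ℝ) {N : ℕ} (A : ℝ → Matrix (Fin N) (Fin N) ℂ)
    (U : ℝ → ℝ → Matrix (Fin N) (Fin N) ℂ) : Prop :=
  ∀ t ∈ I, U t t = 1 ∧ ∀ t' ∈ I, t ≤ t' → ∀ i j,
    HasDerivWithinAt (fun s => U s t i j) ((A t' * U t' t) i j) (I ∩ Set.Ici t) t'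

/-- The variables of the (ordinary) non-Hermitian Lanczos algorithm after `k` iterations: the row
vectors `w_{k-1}^H`, `w_k^H`, the column vectors `v_{k-1}`, `v_k` and the coefficient `β_k`. -/
structure LanczosState (N : ℕ) where
  wPrev : Fin N → ℂ
  wCur : Fin N → ℂ
  vPrev : Fin N → ℂ
  vCur : Fin N → ℂ
  beta : ℂ

/-- The non-Hermitian Lanczos algorithm with inputs `A`, `w`, `v`. It starts from
`w_{-1} = v_{-1} = 0`, `w_0 = w`, `v_0 = v`, and the iteration `k + 1` computes
`α_k = w_k^H A v_k`, `w_{k+1}^H = w_k^H A - α_k w_k^H - β_k w_{k-1}^H`,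
`v̂_{k+1} = A v_k - α_k v_k - v_{k-1}`, `β_{k+1} = w_{k+1}^H v̂_{k+1}` and
`v_{k+1} = v̂_{k+1} / β_{k+1}`. -/
noncomputable def lanczos {N : ℕ} (A : Matrix (Fin N) (Fin N) ℂ) (w v : Fin N → ℂ) :
    ℕ → LanczosState N
  | 0 => ⟨0, star w, 0, v, 0⟩
  | k + 1 =>
    let s := lanczos A w v k
    let α : ℂ := s.wCur ⬝ᵥ (A *ᵥ s.vCur)
    let w' : Fin N → ℂ := s.wCur ᵥ* A - α • s.wCur - s.beta • s.wPrev
    let v' : Fin N → ℂ := A *ᵥ s.vCur - α • s.vCur - s.vPrev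
    ⟨s.wCur, w', s.vCur, (w' ⬝ᵥ v')⁻¹ • v', w' ⬝ᵥ v'⟩

/-- The Lanczos algorithm breaks down in iteration `k ≥ 1` if `β_k = w_k^H v̂_k = 0`, so that
`v_k` cannot be formed. -/
def LanczosBreakdown {N : ℕ} (A : Matrix (Fin N) (Fin N) ℂ) (w v : Fin N → ℂ) (k : ℕ) : Prop :=
  (lanczos A w v k).beta = 0

/-!
The proof runs the non-Hermitian Lanczos algorithm directly in the noncommutative ring of
distributions, with input `Ã(t') Θ(t' - t)`, and controls it by leading symbols.

Every distribution that occurs is built from multiplications by smooth functions, from `δ'` and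
from its inverse `Θ`. Such a distribution `x` has an order `m` and a leading symbol `f`, a smooth
function on `I`: this means that `δ^(m) ∗ x` is `f(t') δ` plus an integral operator with a separable
kernel `∑ g(t') h(t) Θ(t' - t)` (`VolterraCalculus.HasSymbol`). Since the commutator of `δ'` with
the multiplication by `f` is the multiplication by `f'`, and by integration by parts, separable kernels
are stable under products and under conjugation by `δ'`. Hence orders add up and symbols multiply
(`VolterraCalculus.HasSymbol.mul`). Separable kernels also reduce all questions of smoothness to
functions of one variable: the inverse of `1 - G Θ H`, where `G` is a row and `H` a column of
functions, is `1 + G Φ Θ Φ⁻¹ H`, where `Φ` solves the linear differential equation `Φ' = H G Φ`. So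
an operator whose symbol vanishes nowhere is invertible in the calculus
(`VolterraCalculus.HasSymbol.inverse`).

In the Lanczos algorithm for distributions, the `k`th row has order `k`, the `k`th column has
order `-k`, `α_k` has order `1` and `β_k` has order `2`, and the leading symbols at `t` are the
corresponding quantities of the ordinary Lanczos algorithm for `Ã(t)`
(`hasOrderSymbol_ringLanczos`). In particular the symbol of `β_k` vanishes nowhere, by the
assumption of no breakdown, so that `β_k` is invertible. An operator of order `2` with symbol `b` has a kernel
that vanishes on the diagonal, with derivatives `b` and `-b` there (`exists_kernel_of_order_two`),
and its inverse, which has order `-2`, is `δ^(3)` times an operator of order `1`.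

The rows `W` and columns `V` produced by the algorithm satisfy `W V = 1`. Then `1 - V W` is an
idempotent matrix of Volterra operators; the powers of such a matrix tend to zero, so it vanishes
and `W` is invertible (`lanczosCols_mul_lanczosRows`). Consequently the recurrence stops after `N`
steps, and `T = W A W⁻¹` is tridiagonal (`lanczosRows_mul`). All the assertions on the powers and on
the resolvent of `T` follow from those for `A`, for which `Θ ∗ R(A)` is
`Φ Θ Φ⁻¹`, with kernel the time-ordered exponential `U` (`exists_resolvent`).
-/

/-! ### Multiplication, differentiation and integration of test functions -/

section Operators

open MeasureTheory Set Filter Topology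

variable {I : Set ℝ} [I.OrdConnected] [Nontrivial I]

/-- The algebra of the functions that are smooth on `I`. Their values outside `I` are
irrelevant. -/
def SmoothFn (I : Set ℝ) : Subalgebra ℂ (ℝ → ℂ) where
  carrier := {f | ContDiffOn ℝ ∞ f I}
  mul_mem' h k := h.mul k
  add_mem' h k := h.add k
  algebraMap_mem' _ := contDiffOn_const

theorem TestSpace.eq_zero_of_notMem (φ : TestSpace I) {s : ℝ} (hs : s ∉ I) :
    (φ : ℝ → ℂ) s = 0 :=
  φ.2.2.1 s hs

theorem TestSpace.ext_on {φ ψ : TestSpace I} (h : ∀ s ∈ I, (φ : ℝ → ℂ) s = (ψ : ℝ → ℂ) s) :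
    φ = ψ := by
  ext s
  by_cases hs : s ∈ I
  · exact h s hs
  · rw [φ.2.2.1 s hs, ψ.2.2.1 s hs]

/-- The distribution `f(t') δ(t' - t)`, which acts as multiplication by the function `f`. -/
def mulOp (I : Set ℝ) [I.OrdConnected] [Nontrivial I] : SmoothFn I →ₐ[ℂ] StarAlgebra I where
  toFun f :=
    { toFun := fun φ => ⟨fun t => (f : ℝ → ℂ) t * (φ : ℝ → ℂ) t, by
        obtain ⟨φ, h1, h2, c, hc, h3⟩ := φ
        exact ⟨f.2.mul h1, fun t ht => by simp [h2 t ht], c, hc, fun t ht => by simp [h3 t ht]⟩⟩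
      map_add' := fun φ ψ => by ext t; simp [mul_add]
      map_smul' := fun z φ => by ext t; simp [mul_left_comm] }
  map_one' := by ext φ t; simp
  map_mul' f g := by ext φ t; simp [mul_assoc]
  map_zero' := by ext φ t; simp
  map_add' f g := by ext φ t; simp [add_mul]
  commutes' z := by ext φ t; simp

@[simp] theorem mulOp_apply (f : SmoothFn I) (φ : TestSpace I) (t : ℝ) :
    (mulOp I f φ : ℝ → ℂ) t = (f : ℝ → ℂ) t * (φ : ℝ → ℂ) t := rfl

theorem mulOp_congr {f g : SmoothFn I} (h : EqOn (f : ℝ → ℂ) g I) : mulOp I f = mulOp I g := by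
  refine LinearMap.ext fun φ => TestSpace.ext_on fun s hs => ?_
  simp [h hs]

theorem SmoothKernel.dist_apply (f : SmoothKernel I) (φ : TestSpace I) {s : ℝ} (hs : s ∈ I) :
    (f.dist φ : ℝ → ℂ) s = ∫ t in Iic s, f s t * (φ : ℝ → ℂ) t :=
  indicator_of_mem hs fun s => ∫ t in Iic s, f s t * (φ : ℝ → ℂ) t

theorem thetaDist_apply (φ : TestSpace I) {s : ℝ} (hs : s ∈ I) :
    (thetaDist I φ : ℝ → ℂ) s = ∫ t in Iic s, (φ : ℝ → ℂ) t := by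
  rw [thetaDist, SmoothKernel.dist_apply _ _ hs]
  simp

/-- For functions vanishing up to `c`, this also covers `s < c`, where both sides are zero. -/
theorem setIntegral_Iic_eq_intervalIntegral {g : ℝ → ℂ} {c s : ℝ} (hz : ∀ t ≤ c, g t = 0) :
    ∫ t in Iic s, g t = ∫ t in c..s, g t := by
  rcases le_total c s with hcs | hcs
  · rw [intervalIntegral.integral_of_le hcs]
    refine (setIntegral_eq_of_subset_of_forall_sdiff_eq_zero measurableSet_Iic
      Ioc_subset_Iic_self fun t ht => hz t ?_)
    by_contra hlt
    exact ht.2 ⟨not_le.1 hlt, ht.1⟩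
  · have h0 : ∫ t in Iic s, g t = 0 :=
      setIntegral_eq_zero_of_forall_eq_zero fun t ht => hz t (le_trans (mem_Iic.1 ht) hcs)
    refine h0.trans ?_
    rw [intervalIntegral.integral_zero_ae]
    refine Filter.Eventually.of_forall fun t ht => hz t ?_
    rw [uIoc_of_ge hcs] at ht
    exact ht.2

theorem deltaDist_apply (j : ℕ) (φ : TestSpace I) {s : ℝ} (hs : s ∈ I) :
    (deltaDist I j φ : ℝ → ℂ) s = iteratedDerivWithin j (φ : ℝ → ℂ) I s :=
  indicator_of_mem hs _

theorem deltaDist_one_apply (φ : TestSpace I) {s : ℝ} (hs : s ∈ I) :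
    (deltaDist I 1 φ : ℝ → ℂ) s = derivWithin (φ : ℝ → ℂ) I s := by
  rw [deltaDist_apply 1 φ hs, iteratedDerivWithin_one]

theorem hasDerivWithinAt_integral {I : Set ℝ} [I.OrdConnected] {g : ℝ → ℂ}
    (hg : ContinuousOn g I) {c x : ℝ} (hc : c ∈ I)
    (hx : x ∈ I) : HasDerivWithinAt (fun y => ∫ t in c..y, g t) (g x) I x := by
  obtain ⟨a, ha, b, hb, hab, hc', hx', hn⟩ := exists_Icc_mem_nhdsWithin I hc hx
  have hs : Icc a b ⊆ I := Set.Icc_subset I ha hb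
  have := hasDerivWithinAt_integral_param_Icc hab (h := fun _ t => g t) (D := fun _ _ => 0)
    ((hg.mono hs).comp continuousOn_snd fun p hp => hp.2) continuousOn_const
    (fun x _ t _ => hasDerivWithinAt_const _ _ _) hc' hx'
  simp only [intervalIntegral.integral_zero, add_zero] at this
  exact this.mono_of_mem_nhdsWithin hn

theorem eqOn_const_of_hasDerivWithinAt_zero {s : Set ℝ} (hs : Convex ℝ s) {f : ℝ → ℂ}
    (h : ∀ x ∈ s, HasDerivWithinAt f 0 s x) {x y : ℝ} (hx : x ∈ s) (hy : y ∈ s) : f x = f y := by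
  have := hs.norm_image_sub_le_of_norm_hasDerivWithin_le (f := f) (f' := fun _ => 0) (C := 0)
    h (by simp) hy hx
  simpa [sub_eq_zero] using this

theorem convex_interval (I : Set ℝ) [I.OrdConnected] : Convex ℝ I :=
  convex_iff_ordConnected.2 inferInstance

theorem deltaDist_one_mul_thetaDist : deltaDist I 1 * thetaDist I = 1 := by
  refine LinearMap.ext fun φ => TestSpace.ext_on fun s hs => ?_
  rw [Module.End.mul_apply, deltaDist_one_apply _ hs]
  obtain ⟨c, hc, h3⟩ := φ.2.2.2
  have h : HasDerivWithinAt (thetaDist I φ : ℝ → ℂ) ((φ : ℝ → ℂ) s) I s :=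
    (hasDerivWithinAt_integral φ.2.1.continuousOn (interior_subset hc) hs).congr_of_mem
      (fun x hx => by
        rw [thetaDist_apply φ hx, setIntegral_Iic_eq_intervalIntegral h3]) hs
  rw [h.derivWithin (uniqueDiffOn_interval I s hs)]
  rfl

theorem hasDerivWithinAt_testSpace (φ : TestSpace I) {s : ℝ} (hs : s ∈ I) :
    HasDerivWithinAt (φ : ℝ → ℂ) ((deltaDist I 1 φ : ℝ → ℂ) s) I s := by
  rw [deltaDist_one_apply _ hs]
  exact ((φ.2.1.differentiableOn (by simp)) s hs).hasDerivWithinAt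

theorem deltaDist_one_injective {φ : TestSpace I} (h : deltaDist I 1 φ = 0) : φ = 0 := by
  refine TestSpace.ext_on fun s hs => ?_
  obtain ⟨c, hc, h3⟩ := φ.2.2.2
  refine (eqOn_const_of_hasDerivWithinAt_zero (convex_interval I) (fun x hx => ?_) hs
    (interior_subset hc)).trans (h3 c le_rfl)
  simpa [h] using hasDerivWithinAt_testSpace φ hx

theorem thetaDist_mul_deltaDist_one : thetaDist I * deltaDist I 1 = 1 := by
  refine LinearMap.ext fun φ => ?_
  rw [← sub_eq_zero]
  apply deltaDist_one_injective
  have h : deltaDist I 1 * (thetaDist I * deltaDist I 1) = deltaDist I 1 := by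
    rw [← mul_assoc, deltaDist_one_mul_thetaDist, one_mul]
  have := congrArg (fun x => x φ) h
  simpa [sub_eq_zero] using this

/-- `δ'` as a unit of the algebra of distributions; its inverse is `Θ`. -/
noncomputable def deltaUnit (I : Set ℝ) [I.OrdConnected] [Nontrivial I] : (StarAlgebra I)ˣ :=
  ⟨deltaDist I 1, thetaDist I, deltaDist_one_mul_thetaDist, thetaDist_mul_deltaDist_one⟩

theorem deltaDist_eq_pow (j : ℕ) : deltaDist I j = deltaDist I 1 ^ j := by
  induction j with
  | zero => rw [pow_zero, deltaDist_zero]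
  | succ j ih =>
    rw [pow_succ', ← ih]
    refine LinearMap.ext fun φ => TestSpace.ext_on fun s hs => ?_
    rw [Module.End.mul_apply, deltaDist_one_apply _ hs, deltaDist_apply _ _ hs,
      iteratedDerivWithin_succ]
    exact derivWithin_congr (fun x hx => (deltaDist_apply j φ hx).symm)
      (deltaDist_apply j φ hs).symm

theorem hasDerivWithinAt_smoothFn {I : Set ℝ} (f : SmoothFn I) {s : ℝ} (hs : s ∈ I) :
    HasDerivWithinAt (f : ℝ → ℂ) (derivWithin (f : ℝ → ℂ) I s) I s :=
  ((ContDiffOn.differentiableOn f.2 (by simp)) s hs).hasDerivWithinAt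

/-- The derivative on `I`. It is set to zero outside `I`, which makes it linear there. -/
noncomputable def derivFn (I : Set ℝ) [I.OrdConnected] [Nontrivial I] :
    SmoothFn I →ₗ[ℂ] SmoothFn I where
  toFun f := ⟨I.indicator (derivWithin (f : ℝ → ℂ) I),
    ((contDiffOn_infty_iff_derivWithin (uniqueDiffOn_interval I)).1 f.2).2.congr
      fun _ ht => indicator_of_mem ht _⟩
  map_add' f g := by
    ext s
    by_cases hs : s ∈ I
    · simpa [hs] using
        ((hasDerivWithinAt_smoothFn f hs).add (hasDerivWithinAt_smoothFn g hs)).derivWithin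
          (uniqueDiffOn_interval I s hs)
    · simp [hs]
  map_smul' z f := by
    ext s
    by_cases hs : s ∈ I
    · simpa [hs] using ((hasDerivWithinAt_smoothFn f hs).const_smul z).derivWithin
        (uniqueDiffOn_interval I s hs)
    · simp [hs]

theorem hasDerivWithinAt_derivFn (f : SmoothFn I) {s : ℝ} (hs : s ∈ I) :
    HasDerivWithinAt (f : ℝ → ℂ) ((derivFn I f : ℝ → ℂ) s) I s := by
  simpa [derivFn, hs] using hasDerivWithinAt_smoothFn f hs

theorem derivFn_apply_of_hasDerivWithinAt {f : SmoothFn I} {s : ℝ} {a : ℂ} (hs : s ∈ I)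
    (h : HasDerivWithinAt (f : ℝ → ℂ) a I s) : (derivFn I f : ℝ → ℂ) s = a :=
  by rw [← (hasDerivWithinAt_derivFn f hs).derivWithin (uniqueDiffOn_interval I s hs),
    h.derivWithin (uniqueDiffOn_interval I s hs)]

/-- A point of the interval, at which antiderivatives are normalized to vanish. -/
noncomputable def basePoint (I : Set ℝ) [Nontrivial I] : ℝ := (Classical.arbitrary I : I)

theorem basePoint_mem (I : Set ℝ) [Nontrivial I] : basePoint I ∈ I :=
  (Classical.arbitrary I : I).2

/-- The antiderivative on `I` that vanishes at the base point, set to zero outside `I`. -/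
noncomputable def integralFn (I : Set ℝ) [I.OrdConnected] [Nontrivial I] :
    SmoothFn I →ₗ[ℂ] SmoothFn I where
  toFun f := ⟨I.indicator fun s => ∫ t in (basePoint I)..s, (f : ℝ → ℂ) t,
    ContDiffOn.congr (contDiffOn_infty.2 fun n => contDiffOn_integral_param I (basePoint_mem I) n
      (fun _ t => (f : ℝ → ℂ) t) (f.2.comp contDiffOn_snd fun _ hp => hp.2))
      fun _ ht => indicator_of_mem ht _⟩
  map_add' f g := by
    ext s
    by_cases hs : s ∈ I
    · have hi : ∀ f : SmoothFn I, IntervalIntegrable (f : ℝ → ℂ) volume (basePoint I) s :=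
        fun f => ((ContDiffOn.continuousOn f.2).mono
          (Set.OrdConnected.uIcc_subset inferInstance (basePoint_mem I) hs)).intervalIntegrable
      simpa [hs] using intervalIntegral.integral_add (hi f) (hi g)
    · simp [hs]
  map_smul' z f := by
    ext s
    by_cases hs : s ∈ I <;> simp [hs]

theorem derivFn_integralFn (f : SmoothFn I) {s : ℝ} (hs : s ∈ I) :
    (derivFn I (integralFn I f) : ℝ → ℂ) s = (f : ℝ → ℂ) s := by
  refine derivFn_apply_of_hasDerivWithinAt hs ?_
  exact (hasDerivWithinAt_integral (ContDiffOn.continuousOn f.2) (basePoint_mem I) hs).congr_of_mem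
    (fun x hx => indicator_of_mem hx fun s => ∫ t in (basePoint I)..s, (f : ℝ → ℂ) t) hs

/-- The Leibniz rule, as a commutation relation. -/
theorem deltaDist_one_mul_mulOp (f : SmoothFn I) :
    deltaDist I 1 * mulOp I f = mulOp I f * deltaDist I 1 + mulOp I (derivFn I f) := by
  refine LinearMap.ext fun φ => TestSpace.ext_on fun s hs => ?_
  rw [Module.End.mul_apply, deltaDist_one_apply _ hs]
  have h := (hasDerivWithinAt_derivFn f hs).mul (hasDerivWithinAt_testSpace φ hs)
  refine HasDerivWithinAt.derivWithin (h.congr_deriv ?_) (uniqueDiffOn_interval I s hs)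
  simp [add_comm]

end Operators

/-! ### An algebraic calculus of Volterra operators -/

section Calculus

open scoped TensorProduct

/-- The algebraic data of a calculus of Volterra operators: an algebra `C` of functions with a
derivation and antiderivatives, an algebra `R` of operators that contains the multiplications by
these functions (through `mulOp`) and an invertible operator `D` of differentiation. The Volterra
operator `D⁻¹` is written `Θ`. The last field states that linear differential equations can be
solved: if `Φ' = B Φ` and `Ψ = Φ⁻¹`, then `K = Φ Θ Ψ` is the inverse of `D - B`. -/
structure VolterraCalculus (R C : Type*) [Ring R] [Algebra ℂ R] [CommRing C] [Algebra ℂ C] where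
  mulOp : C →ₐ[ℂ] R
  D : Rˣ
  deriv : C →ₗ[ℂ] C
  integral : C →ₗ[ℂ] C
  leibniz : ∀ f, (D : R) * mulOp f = mulOp f * D + mulOp (deriv f)
  mulOp_deriv_integral : ∀ f, mulOp (deriv (integral f)) = mulOp f
  exists_fundamental : ∀ (m : ℕ) (B : Matrix (Fin m) (Fin m) C),
    ∃ Φ Ψ : Matrix (Fin m) (Fin m) C,
      Φ.map mulOp * Ψ.map mulOp = 1 ∧
      (Φ.map deriv).map mulOp = B.map mulOp * Φ.map mulOp ∧
      (Ψ.map deriv).map mulOp = -(Ψ.map mulOp * B.map mulOp)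

namespace VolterraCalculus

variable {R C : Type*} [Ring R] [Algebra ℂ R] [CommRing C] [Algebra ℂ C]
  (V : VolterraCalculus R C)

/-- The Volterra operator of integration, the inverse of `D`. -/
def Θ : R := ↑V.D⁻¹

theorem D_mul_Θ : (V.D : R) * V.Θ = 1 := V.D.mul_inv

theorem Θ_mul_D : V.Θ * (V.D : R) = 1 := V.D.inv_mul

theorem mulOp_comm (f g : C) : V.mulOp f * V.mulOp g = V.mulOp g * V.mulOp f := by
  rw [← map_mul, mul_comm, map_mul]

theorem Θ_mul_mulOp_deriv_mul_Θ (f : C) :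
    V.Θ * V.mulOp (V.deriv f) * V.Θ = V.mulOp f * V.Θ - V.Θ * V.mulOp f := by
  have h : V.mulOp (V.deriv f) = V.D * V.mulOp f - V.mulOp f * V.D := by
    rw [V.leibniz, add_sub_cancel_left]
  rw [h, mul_sub, sub_mul, ← mul_assoc, V.Θ_mul_D, one_mul, mul_assoc, mul_assoc, V.D_mul_Θ,
    mul_one]

/-- Integration by parts. -/
theorem Θ_mul_mulOp_mul_Θ (f : C) :
    V.Θ * V.mulOp f * V.Θ = V.mulOp (V.integral f) * V.Θ - V.Θ * V.mulOp (V.integral f) := by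
  rw [← V.Θ_mul_mulOp_deriv_mul_Θ, V.mulOp_deriv_integral]

/-- Conjugation by `D` changes a multiplication operator by an integral operator only; this is why
leading symbols are multiplicative. -/
theorem Θ_mul_mulOp_mul_D (f : C) :
    V.Θ * V.mulOp f * V.D = V.mulOp f - V.Θ * V.mulOp (V.deriv f) := by
  have h : V.mulOp f * V.D = V.D * V.mulOp f - V.mulOp (V.deriv f) := by
    rw [V.leibniz, add_sub_cancel_right]
  rw [mul_assoc, h, mul_sub, ← mul_assoc, V.Θ_mul_D, one_mul]

/-! ### Separable kernels -/

/-- The operator with the separable kernel `∑ g(t') h(t) Θ(t' - t)`, for `∑ g ⊗ h`. -/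
noncomputable def sep : C ⊗[ℂ] C →ₗ[ℂ] R :=
  LinearMap.mul' ℂ R ∘ₗ TensorProduct.map V.mulOp.toLinearMap
    (LinearMap.mulLeft ℂ V.Θ ∘ₗ V.mulOp.toLinearMap)

theorem sep_tmul (g h : C) : V.sep (g ⊗ₜ h) = V.mulOp g * V.Θ * V.mulOp h := by
  simp [sep, mul_assoc]

/-- The operators with a separable kernel. -/
noncomputable def sepOps : Submodule ℂ R := LinearMap.range V.sep

theorem mulOp_Θ_mulOp_mem (g h : C) : V.mulOp g * V.Θ * V.mulOp h ∈ V.sepOps :=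
  ⟨g ⊗ₜ h, V.sep_tmul g h⟩

theorem sepOps_induction {p : R → Prop} (h0 : p 0) (hadd : ∀ x y, p x → p y → p (x + y))
    (h : ∀ g h, p (V.mulOp g * V.Θ * V.mulOp h)) {x : R} (hx : x ∈ V.sepOps) : p x := by
  obtain ⟨z, rfl⟩ := hx
  induction z with
  | zero => simpa using h0
  | tmul g k => rw [sep_tmul]; exact h g k
  | add z w hz hw => rw [map_add]; exact hadd _ _ hz hw

theorem mulOp_mul_mem (f : C) {x : R} (hx : x ∈ V.sepOps) : V.mulOp f * x ∈ V.sepOps := by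
  refine V.sepOps_induction (p := fun x => V.mulOp f * x ∈ V.sepOps) (by simp)
    (fun x y hx hy => ?_) (fun g h => ?_) hx
  · simpa [mul_add] using add_mem hx hy
  · rw [← mul_assoc, ← mul_assoc, ← map_mul]; exact V.mulOp_Θ_mulOp_mem _ _

theorem mul_mulOp_mem (f : C) {x : R} (hx : x ∈ V.sepOps) : x * V.mulOp f ∈ V.sepOps := by
  refine V.sepOps_induction (p := fun x => x * V.mulOp f ∈ V.sepOps) (by simp)
    (fun x y hx hy => ?_) (fun g h => ?_) hx
  · simpa [add_mul] using add_mem hx hy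
  · rw [mul_assoc, ← map_mul]; exact V.mulOp_Θ_mulOp_mem _ _

theorem mulOp_Θ_mem (g : C) : V.mulOp g * V.Θ ∈ V.sepOps := by
  simpa using V.mulOp_Θ_mulOp_mem g 1

theorem Θ_mulOp_mem (g : C) : V.Θ * V.mulOp g ∈ V.sepOps := by
  simpa using V.mulOp_Θ_mulOp_mem 1 g

theorem Θ_mulOp_Θ_mem (g : C) : V.Θ * V.mulOp g * V.Θ ∈ V.sepOps := by
  rw [V.Θ_mul_mulOp_mul_Θ]
  exact sub_mem (V.mulOp_Θ_mem _) (V.Θ_mulOp_mem _)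

theorem mul_mem {x y : R} (hx : x ∈ V.sepOps) (hy : y ∈ V.sepOps) : x * y ∈ V.sepOps := by
  refine V.sepOps_induction (p := fun x => x * y ∈ V.sepOps) (by simp)
    (fun x y hx hy => ?_) (fun g h => ?_) hx
  · simpa [add_mul] using add_mem hx hy
  refine V.sepOps_induction (p := fun y => V.mulOp g * V.Θ * V.mulOp h * y ∈ V.sepOps) (by simp)
    (fun x y hx hy => ?_) (fun g' h' => ?_) hy
  · simpa [mul_add] using add_mem hx hy
  have : V.mulOp g * V.Θ * V.mulOp h * (V.mulOp g' * V.Θ * V.mulOp h')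
      = V.mulOp g * (V.Θ * V.mulOp (h * g') * V.Θ) * V.mulOp h' := by
    simp only [map_mul, mul_assoc]
  rw [this]
  exact V.mul_mulOp_mem _ (V.mulOp_mul_mem _ (V.Θ_mulOp_Θ_mem _))

theorem D_mul_Θ_mem {x : R} (hx : x ∈ V.sepOps) : V.D * x * V.Θ ∈ V.sepOps := by
  refine V.sepOps_induction (p := fun x => V.D * x * V.Θ ∈ V.sepOps) (by simp)
    (fun x y hx hy => ?_) (fun g h => ?_) hx
  · simpa [mul_add, add_mul] using add_mem hx hy
  have : V.D * (V.mulOp g * V.Θ * V.mulOp h) * V.Θ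
      = V.mulOp (g * h) * V.Θ + V.mulOp (V.deriv g) * (V.Θ * V.mulOp h * V.Θ) := by
    have e : V.D * (V.mulOp g * V.Θ * V.mulOp h) * V.Θ
      = V.D * V.mulOp g * (V.Θ * V.mulOp h * V.Θ) := by simp only [mul_assoc]
    rw [e, V.leibniz, add_mul, map_mul]
    congr 1
    calc _ = V.mulOp g * (V.D * V.Θ) * V.mulOp h * V.Θ := by simp only [mul_assoc]
      _ = _ := by rw [V.D_mul_Θ, mul_one]
  rw [this]
  exact add_mem (V.mulOp_Θ_mem _) (V.mulOp_mul_mem _ (V.Θ_mulOp_Θ_mem _))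

theorem Θ_mul_D_mem {x : R} (hx : x ∈ V.sepOps) : V.Θ * x * V.D ∈ V.sepOps := by
  refine V.sepOps_induction (p := fun x => V.Θ * x * V.D ∈ V.sepOps) (by simp)
    (fun x y hx hy => ?_) (fun g h => ?_) hx
  · simpa [mul_add, add_mul] using add_mem hx hy
  have : V.Θ * (V.mulOp g * V.Θ * V.mulOp h) * V.D = V.Θ * V.mulOp (V.deriv (V.integral g * h))
      - (V.mulOp (V.integral g) * V.Θ * V.mulOp (V.deriv h)) := by
    calc _ = (V.Θ * V.mulOp g * V.Θ) * (V.mulOp h * V.D) := by simp only [mul_assoc]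
      _ = V.mulOp (V.integral g) * (V.Θ * V.mulOp h * V.D)
          - V.Θ * V.mulOp (V.integral g * h) * V.D := by
        rw [V.Θ_mul_mulOp_mul_Θ, sub_mul, map_mul]; simp only [mul_assoc]
      _ = _ := by
        rw [V.Θ_mul_mulOp_mul_D, V.Θ_mul_mulOp_mul_D, map_mul, mul_sub, mul_assoc]; abel
  rw [this]
  exact sub_mem (V.Θ_mulOp_mem _) (V.mulOp_Θ_mulOp_mem _ _)

/-! ### Orders and leading symbols -/

/-- `x` has order `m` and leading symbol `f` if `D ^ m x` is the sum of the multiplication by `f`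
and of an operator with a separable kernel. Here `x` behaves like `m`-fold integration, so that
operators of large order are very regular; the order may be negative. -/
def HasSymbol (m : ℤ) (x : R) (f : C) : Prop := ↑(V.D ^ m) * x - V.mulOp f ∈ V.sepOps

variable {V}

/-- The class of operators `mulOp f + s`, with `s` of separable kernel, and the symbol `f` are
preserved under conjugation by powers of `D`. -/
theorem conj_mem (n : ℤ) {x : R} {f : C} (h : x - V.mulOp f ∈ V.sepOps) :
    ↑(V.D ^ n) * x * ↑(V.D ^ (-n)) - V.mulOp f ∈ V.sepOps := by
  induction n with
  | zero => simpa using h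
  | succ n ih =>
    set y := ↑(V.D ^ (n : ℤ)) * x * ↑(V.D ^ (-(n : ℤ))) with hy
    have e : ↑(V.D ^ ((n : ℤ) + 1)) * x * ↑(V.D ^ (-((n : ℤ) + 1))) - V.mulOp f
        = V.D * (y - V.mulOp f) * V.Θ + V.mulOp (V.deriv f) * V.Θ := by
      have e1 : ↑(V.D ^ ((n : ℤ) + 1)) * x * ↑(V.D ^ (-((n : ℤ) + 1))) = V.D * y * V.Θ := by
        rw [add_comm, neg_add_rev, zpow_add, zpow_add, zpow_one, zpow_neg_one, Units.val_mul,
          Units.val_mul, hy, Θ]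
        simp only [mul_assoc]
      rw [e1, mul_sub, V.leibniz, sub_mul, add_mul, mul_assoc (V.mulOp f), V.D_mul_Θ, mul_one]
      abel
    rw [e]
    exact add_mem (V.D_mul_Θ_mem ih) (V.mulOp_Θ_mem _)
  | pred n ih =>
    set y := ↑(V.D ^ (-(n : ℤ))) * x * ↑(V.D ^ (-(-(n : ℤ)))) with hy
    have e : ↑(V.D ^ (-(n : ℤ) - 1)) * x * ↑(V.D ^ (-(-(n : ℤ) - 1))) - V.mulOp f
        = V.Θ * (y - V.mulOp f) * V.D - V.Θ * V.mulOp (V.deriv f) := by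
      have e1 : ↑(V.D ^ (-(n : ℤ) - 1)) * x * ↑(V.D ^ (-(-(n : ℤ) - 1))) = V.Θ * y * V.D := by
        rw [show -(-(n : ℤ) - 1) = -(-(n : ℤ)) + 1 by ring,
          show -(n : ℤ) - 1 = -1 + -(n : ℤ) by ring, zpow_add, zpow_add, zpow_one, zpow_neg_one,
          Units.val_mul, Units.val_mul, hy, Θ]
        simp only [mul_assoc]
      rw [e1, mul_sub, sub_mul, V.Θ_mul_mulOp_mul_D]
      abel
    rw [e]
    exact sub_mem (V.Θ_mul_D_mem ih) (V.Θ_mulOp_mem _)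

theorem HasSymbol.add {m : ℤ} {x y : R} {f g : C} (hx : V.HasSymbol m x f)
    (hy : V.HasSymbol m y g) : V.HasSymbol m (x + y) (f + g) := by
  have e : ↑(V.D ^ m) * (x + y) - V.mulOp (f + g)
      = (↑(V.D ^ m) * x - V.mulOp f) + (↑(V.D ^ m) * y - V.mulOp g) := by
    rw [mul_add, map_add]; abel
  rw [HasSymbol, e]
  exact add_mem hx hy

theorem HasSymbol.neg {m : ℤ} {x : R} {f : C} (hx : V.HasSymbol m x f) :
    V.HasSymbol m (-x) (-f) := by
  have e : ↑(V.D ^ m) * (-x) - V.mulOp (-f) = -(↑(V.D ^ m) * x - V.mulOp f) := by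
    rw [map_neg, mul_neg]; abel
  rw [HasSymbol, e]
  exact neg_mem hx

theorem HasSymbol.sub {m : ℤ} {x y : R} {f g : C} (hx : V.HasSymbol m x f)
    (hy : V.HasSymbol m y g) : V.HasSymbol m (x - y) (f - g) := by
  simpa only [sub_eq_add_neg] using hx.add hy.neg

theorem hasSymbol_zero (m : ℤ) : V.HasSymbol m 0 0 := by
  simp [HasSymbol]

theorem hasSymbol_mulOp (f : C) : V.HasSymbol 0 (V.mulOp f) f := by
  simp [HasSymbol]

theorem hasSymbol_Θ : V.HasSymbol 1 V.Θ 1 := by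
  simp [HasSymbol, V.D_mul_Θ]

/-- Orders add up and symbols multiply. -/
theorem HasSymbol.mul {m n : ℤ} {x y : R} {f g : C} (hx : V.HasSymbol m x f)
    (hy : V.HasSymbol n y g) : V.HasSymbol (m + n) (x * y) (f * g) := by
  have h := conj_mem n hx
  set s := ↑(V.D ^ n) * (↑(V.D ^ m) * x) * ↑(V.D ^ (-n)) - V.mulOp f with hs
  set s' := ↑(V.D ^ n) * y - V.mulOp g with hs'
  have e : ↑(V.D ^ (m + n)) * (x * y) = (V.mulOp f + s) * (V.mulOp g + s') := by
    rw [hs, hs', add_sub_cancel, add_sub_cancel, add_comm m n, zpow_add, Units.val_mul]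
    have : (↑(V.D ^ (-n)) : R) * ↑(V.D ^ n) = 1 := by
      rw [← Units.val_mul, ← zpow_add, neg_add_cancel, zpow_zero, Units.val_one]
    calc _ = ↑(V.D ^ n) * (↑(V.D ^ m) * x) * 1 * y := by simp only [mul_assoc, one_mul]
      _ = _ := by rw [← this]; simp only [mul_assoc]
  have e' : ↑(V.D ^ (m + n)) * (x * y) - V.mulOp (f * g)
      = V.mulOp f * s' + s * V.mulOp g + s * s' := by
    rw [e, map_mul]; noncomm_ring
  rw [HasSymbol, e']
  exact add_mem (add_mem (V.mulOp_mul_mem _ hy) (V.mul_mulOp_mem _ h)) (V.mul_mem h hy)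

/-- Operators of order `0` whose symbol acts as zero have separable kernels. -/
theorem HasSymbol.mem_sepOps {x : R} {f : C} (hx : V.HasSymbol 0 x f) (hf : V.mulOp f = 0) :
    x ∈ V.sepOps := by
  simpa [HasSymbol, hf] using hx

variable (V) in
/-- On separable kernels, left multiplication by `Θ` is given by
`g ⊗ h ↦ G ⊗ h - 1 ⊗ G h`, where `G` is the antiderivative of `g`. -/
noncomputable def sepIntegral : C ⊗[ℂ] C →ₗ[ℂ] C ⊗[ℂ] C :=
  LinearMap.rTensor C V.integral
    - TensorProduct.mk ℂ C C 1 ∘ₗ LinearMap.mul' ℂ C ∘ₗ LinearMap.rTensor C V.integral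

theorem sepIntegral_tmul (g h : C) :
    V.sepIntegral (g ⊗ₜ h) = V.integral g ⊗ₜ h - 1 ⊗ₜ (V.integral g * h) := rfl

theorem Θ_mul_sep (z : C ⊗[ℂ] C) : V.Θ * V.sep z = V.sep (V.sepIntegral z) := by
  induction z with
  | zero => simp
  | tmul g h =>
    rw [sepIntegral_tmul, map_sub, sep_tmul, sep_tmul, sep_tmul, ← mul_assoc, ← mul_assoc,
      Θ_mul_mulOp_mul_Θ, map_one, one_mul, map_mul, sub_mul, mul_assoc V.Θ]
  | add z w hz hw => rw [map_add, map_add, map_add, mul_add, hz, hw]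

theorem mul'_sepIntegral (z : C ⊗[ℂ] C) : LinearMap.mul' ℂ C (V.sepIntegral z) = 0 := by
  simp [sepIntegral]

/-- An operator of order `1` has a separable kernel, whose values on the diagonal are the symbol. -/
theorem HasSymbol.exists_sep {x : R} {f : C} (hx : V.HasSymbol 1 x f) :
    ∃ z, V.sep z = x ∧ LinearMap.mul' ℂ C z = f := by
  obtain ⟨z, hz⟩ := hx
  rw [zpow_one] at hz
  refine ⟨(1 : C) ⊗ₜ f + V.sepIntegral z, ?_, ?_⟩
  · rw [map_add, ← Θ_mul_sep, hz, sep_tmul, map_one, one_mul, mul_sub, ← mul_assoc, V.Θ_mul_D,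
      one_mul, add_sub_cancel]
  · rw [map_add, mul'_sepIntegral, add_zero, LinearMap.mul'_apply, one_mul]

/-- An operator of order `2` has a separable kernel of the form `Θ * z`, where the values of
`z` on the diagonal are the symbol. -/
theorem HasSymbol.exists_sep_sepIntegral {x : R} {f : C} (hx : V.HasSymbol 2 x f) :
    ∃ z, V.sep (V.sepIntegral z) = x ∧ LinearMap.mul' ℂ C z = f := by
  have h1 : V.HasSymbol 1 (V.D * x) f := by
    rw [HasSymbol, zpow_one, ← mul_assoc]
    rwa [HasSymbol, zpow_ofNat, pow_two, Units.val_mul] at hx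
  obtain ⟨z, hz, hf⟩ := h1.exists_sep
  refine ⟨z, ?_, hf⟩
  rw [← Θ_mul_sep, hz, ← mul_assoc, V.Θ_mul_D, one_mul]

theorem hasSymbol_sum {ι : Type*} (s : Finset ι) {m : ℤ} {x : ι → R} {f : ι → C}
    (h : ∀ i ∈ s, V.HasSymbol m (x i) (f i)) :
    V.HasSymbol m (∑ i ∈ s, x i) (∑ i ∈ s, f i) := by
  classical
  induction s using Finset.induction_on with
  | empty => simpa using hasSymbol_zero m
  | insert a s ha ih =>
    rw [Finset.sum_insert ha, Finset.sum_insert ha]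
    exact (h a (Finset.mem_insert_self _ _)).add
      (ih fun i hi => h i (Finset.mem_insert_of_mem hi))

/-! ### Inverses -/

/-- For a fundamental matrix `Φ` of `Φ' = B Φ`, with inverse `Ψ`, the operator `K = Φ Θ Ψ` is the
inverse of `D - B`. The two equations express this in the form `Θ B K = K - Θ = K B Θ`. -/
theorem fundamental_resolvent {m : ℕ} {B Φ Ψ : Matrix (Fin m) (Fin m) C}
    (h : Φ.map V.mulOp * Ψ.map V.mulOp = 1)
    (hΦ : (Φ.map V.deriv).map V.mulOp = B.map V.mulOp * Φ.map V.mulOp)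
    (hΨ : (Ψ.map V.deriv).map V.mulOp = -(Ψ.map V.mulOp * B.map V.mulOp)) :
    Matrix.diagonal (fun _ => V.Θ) * B.map V.mulOp
        * (Φ.map V.mulOp * Matrix.diagonal (fun _ => V.Θ) * Ψ.map V.mulOp)
      = Φ.map V.mulOp * Matrix.diagonal (fun _ => V.Θ) * Ψ.map V.mulOp
        - Matrix.diagonal (fun _ => V.Θ) ∧
    Φ.map V.mulOp * Matrix.diagonal (fun _ => V.Θ) * Ψ.map V.mulOp * B.map V.mulOp
        * Matrix.diagonal (fun _ => V.Θ)
      = Φ.map V.mulOp * Matrix.diagonal (fun _ => V.Θ) * Ψ.map V.mulOp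
        - Matrix.diagonal (fun _ => V.Θ) := by
  set θ : Matrix (Fin m) (Fin m) R := Matrix.diagonal (fun _ => V.Θ) with hθ
  have key : ∀ X : Matrix (Fin m) (Fin m) C,
      θ * (X.map V.deriv).map V.mulOp * θ = X.map V.mulOp * θ - θ * X.map V.mulOp := by
    intro X
    ext i j
    simpa [hθ] using V.Θ_mul_mulOp_deriv_mul_Θ (X i j)
  have k1 := key Φ
  have k2 := key Ψ
  rw [hΦ] at k1
  rw [hΨ] at k2
  constructor
  · calc _ = θ * (B.map V.mulOp * Φ.map V.mulOp) * θ * Ψ.map V.mulOp := by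
          simp only [mul_assoc]
      _ = Φ.map V.mulOp * θ * Ψ.map V.mulOp - θ * (Φ.map V.mulOp * Ψ.map V.mulOp) := by
          rw [k1, sub_mul, mul_assoc θ]
      _ = _ := by rw [h, mul_one]
  · calc _ = Φ.map V.mulOp * -(θ * -(Ψ.map V.mulOp * B.map V.mulOp) * θ) := by
          simp only [mul_assoc, mul_neg, neg_mul, neg_neg]
      _ = Φ.map V.mulOp * θ * Ψ.map V.mulOp - (Φ.map V.mulOp * Ψ.map V.mulOp) * θ := by
          rw [k2, neg_sub, mul_sub]; simp only [mul_assoc]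
      _ = _ := by rw [h, one_mul]

/-- The inverse of `1 - G θ H` is `1 + G K H`, where `K` is the inverse of `θ⁻¹ - H G`. -/
theorem one_sub_mul_one_add {R : Type*} [Ring R] {p m : Type*} [Fintype p]
    [DecidableEq p] [Fintype m] [DecidableEq m] {G : Matrix p m R} {H : Matrix m p R}
    {θ K : Matrix m m R}
    (h1 : θ * (H * G) * K = K - θ) (h2 : K * (H * G) * θ = K - θ) :
    (1 - G * θ * H) * (1 + G * K * H) = 1 ∧ (1 + G * K * H) * (1 - G * θ * H) = 1 := by
  constructor
  · have e : (1 - G * θ * H) * (1 + G * K * H)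
        = 1 + (G * (K - θ) * H - G * (θ * (H * G) * K) * H) := by
      simp only [sub_mul, mul_add, mul_one, one_mul, Matrix.mul_sub, Matrix.sub_mul,
        Matrix.mul_assoc]
      abel
    rw [e, h1, sub_self, add_zero]
  · have e : (1 + G * K * H) * (1 - G * θ * H)
        = 1 + (G * (K - θ) * H - G * (K * (H * G) * θ) * H) := by
      simp only [add_mul, mul_sub, mul_one, one_mul, Matrix.mul_sub, Matrix.sub_mul,
        Matrix.mul_assoc]
      abel
    rw [e, h2, sub_self, add_zero]

theorem exists_sum_tmul (z : C ⊗[ℂ] C) :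
    ∃ (m : ℕ) (g h : Fin m → C), z = ∑ i, g i ⊗ₜ h i := by
  obtain ⟨S, hS⟩ := TensorProduct.exists_finset z
  refine ⟨S.card, fun i => (S.equivFin.symm i).1.1, fun i => (S.equivFin.symm i).1.2, ?_⟩
  rw [hS, Equiv.sum_comp S.equivFin.symm (fun p => (p.1.1 ⊗ₜ[ℂ] p.1.2 : C ⊗[ℂ] C)),
    Finset.sum_coe_sort S (fun p => (p.1 ⊗ₜ[ℂ] p.2 : C ⊗[ℂ] C))]

/-- Integral operators of the second kind with separable kernels are invertible, and the inverse is
again of this form. -/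
theorem exists_inverse_one_sub {x : R} (hx : x ∈ V.sepOps) :
    ∃ y ∈ V.sepOps, (1 - x) * (1 + y) = 1 ∧ (1 + y) * (1 - x) = 1 := by
  obtain ⟨z, rfl⟩ := hx
  obtain ⟨m, g, h, rfl⟩ := exists_sum_tmul z
  -- `x = G Θ H` for the row `G` and the column `H`
  let G : Matrix Unit (Fin m) R := Matrix.of fun _ j => V.mulOp (g j)
  let H : Matrix (Fin m) Unit R := Matrix.of fun i _ => V.mulOp (h i)
  let B : Matrix (Fin m) (Fin m) C := Matrix.of fun i j => h i * g j
  have hB : B.map V.mulOp = H * G := by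
    ext i j
    simp [B, H, G, Matrix.mul_apply]
  obtain ⟨Φ, Ψ, h0, hΦ, hΨ⟩ := V.exists_fundamental m B
  obtain ⟨h1, h2⟩ := fundamental_resolvent h0 hΦ hΨ
  rw [hB] at h1 h2
  obtain ⟨k1, k2⟩ := one_sub_mul_one_add h1 h2
  set θ : Matrix (Fin m) (Fin m) R := Matrix.diagonal (fun _ => V.Θ) with hθ
  let X : Matrix Unit Unit R := G * θ * H
  let K : Matrix (Fin m) (Fin m) R := Φ.map V.mulOp * θ * Ψ.map V.mulOp
  let Y : Matrix Unit Unit R := G * K * H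
  have eK : ∀ j i, K j i = ∑ k, V.mulOp (Φ j k) * V.Θ * V.mulOp (Ψ k i) := fun j i => by
    simp only [K, hθ, Matrix.mul_apply (N := Ψ.map _), Matrix.mul_diagonal, Matrix.map_apply]
  have eY : Y () () = ∑ i, (∑ j, V.mulOp (g j) * K j i) * V.mulOp (h i) := rfl
  have eX : X () () = V.sep (∑ i, g i ⊗ₜ h i) := by
    simp [X, G, H, hθ, Matrix.mul_apply, Matrix.diagonal_apply, sep_tmul]
  refine ⟨Y () (), ?_, ?_, ?_⟩
  · rw [eY]
    refine sum_mem fun i _ => V.mul_mulOp_mem _ (sum_mem fun j _ => V.mulOp_mul_mem _ ?_)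
    rw [eK]
    exact sum_mem fun k _ => V.mulOp_Θ_mulOp_mem _ _
  · rw [← eX]
    simpa [Matrix.mul_apply (M := 1 - X)] using congrFun₂ (show (1 - X) * (1 + Y) = 1 from k1) () ()
  · rw [← eX]
    simpa [Matrix.mul_apply (M := 1 + Y)] using congrFun₂ (show (1 + Y) * (1 - X) = 1 from k2) () ()

/-- Operators with invertible leading symbol are invertible. -/
theorem HasSymbol.inverse {m : ℤ} {x : R} {f f' : C} (hx : V.HasSymbol m x f)
    (hf : V.mulOp (f * f') = 1) : IsUnit x ∧ V.HasSymbol (-m) (Ring.inverse x) f' := by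
  have hf1 : V.mulOp f * V.mulOp f' = 1 := by rw [← map_mul, hf]
  have hf2 : V.mulOp f' * V.mulOp f = 1 := by rw [V.mulOp_comm, hf1]
  have hs : -(V.mulOp f' * (↑(V.D ^ m) * x - V.mulOp f)) ∈ V.sepOps :=
    neg_mem (V.mulOp_mul_mem f' hx)
  -- Up to the factor `f`, the operator `D ^ m x` is an integral operator of the second kind.
  obtain ⟨y, hy, h1, h2⟩ := exists_inverse_one_sub hs
  have e : 1 - -(V.mulOp f' * (↑(V.D ^ m) * x - V.mulOp f)) = V.mulOp f' * (↑(V.D ^ m) * x) := by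
    rw [mul_sub, hf2]; abel
  rw [e] at h1 h2
  have u1 : (↑(V.D ^ m) * x) * ((1 + y) * V.mulOp f') = 1 := by
    calc _ = V.mulOp f * (V.mulOp f' * (↑(V.D ^ m) * x) * (1 + y)) * V.mulOp f' := by
          simp only [← mul_assoc, hf1, one_mul]
      _ = 1 := by rw [h1, mul_one, hf1]
  have u2 : ((1 + y) * V.mulOp f') * (↑(V.D ^ m) * x) = 1 := by
    rw [mul_assoc, h2]
  have v1 : x * ((1 + y) * V.mulOp f' * ↑(V.D ^ m)) = 1 := by
    calc _ = ↑(V.D ^ m)⁻¹ * ((↑(V.D ^ m) * x) * ((1 + y) * V.mulOp f')) * ↑(V.D ^ m) := by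
          simp only [mul_assoc, Units.inv_mul_cancel_left]
      _ = 1 := by rw [u1, mul_one, Units.inv_mul]
  have v2 : ((1 + y) * V.mulOp f' * ↑(V.D ^ m)) * x = 1 := by
    rw [mul_assoc, u2]
  let u : Rˣ := ⟨x, (1 + y) * V.mulOp f' * ↑(V.D ^ m), v1, v2⟩
  have hu : Ring.inverse x = (1 + y) * V.mulOp f' * ↑(V.D ^ m) := Ring.inverse_unit u
  refine ⟨u.isUnit, ?_⟩
  rw [hu, HasSymbol, ← mul_assoc]
  have := conj_mem (V := V) (x := (1 + y) * V.mulOp f') (f := f') (-m)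
    (by rw [add_mul, one_mul, add_sub_cancel_left]; exact V.mul_mulOp_mem f' hy)
  rwa [neg_neg] at this

end VolterraCalculus
end Calculus

/-! ### Linear differential equations on an interval -/

section LinearODE

open MeasureTheory Set Filter Topology

open scoped Nat

theorem norm_integral_le_pow {f : ℝ → ℂ} {c t L : ℝ} {n : ℕ}
    (h : ∀ s ∈ uIoc c t, ‖f s‖ ≤ L * |s - c| ^ n) :
    ‖∫ s in c..t, f s‖ ≤ L * (|t - c| ^ (n + 1) / (n + 1)) := by
  have hi : IntervalIntegrable (fun s : ℝ => L * |s - c| ^ n) volume c t :=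
    (by fun_prop : Continuous fun s : ℝ => L * |s - c| ^ n).intervalIntegrable _ _
  rw [← integral_pow_abs_sub_uIoc, ← integral_const_mul]
  rw [intervalIntegral.norm_intervalIntegral_eq]
  refine norm_integral_le_of_norm_le hi.def' ?_
  filter_upwards [ae_restrict_mem measurableSet_uIoc] with s hs using h s hs

variable {ι : Type*} [Fintype ι]

/-- The terms of the Picard series of the linear differential equation `y' = B y`, `y(c) = y₀`. -/
noncomputable def picardTerm (B : ι → ι → ℝ → ℂ) (c : ℝ) (y₀ : ι → ℂ) : ℕ → ι → ℝ → ℂ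
  | 0 => fun i _ => y₀ i
  | n + 1 => fun i t => ∫ s in c..t, ∑ j, B i j s * picardTerm B c y₀ n j s

theorem continuousOn_picardTerm {I : Set ℝ} [I.OrdConnected] {B : ι → ι → ℝ → ℂ}
    (hB : ∀ i j, ContinuousOn (B i j) I) {c : ℝ} (hc : c ∈ I) (y₀ : ι → ℂ) (n : ℕ) :
    ∀ i, ContinuousOn (picardTerm B c y₀ n i) I := by
  induction n with
  | zero => exact fun i => continuousOn_const
  | succ n ih =>
    intro i t ht
    exact (hasDerivWithinAt_integral (continuousOn_finsetSum _ fun j _ => (hB i j).mul (ih j))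
      hc ht).continuousWithinAt

/-- The factors `1 / n!` come from the iterated integration. -/
theorem norm_picardTerm_le {B : ι → ι → ℝ → ℂ} {a b c M K : ℝ} (hc : c ∈ Icc a b)
    (hM : ∀ i j, ∀ t ∈ Icc a b, ‖B i j t‖ ≤ M) {y₀ : ι → ℂ} (hK : ∀ i, ‖y₀ i‖ ≤ K) (n : ℕ) :
    ∀ i, ∀ t ∈ Icc a b,
      ‖picardTerm B c y₀ n i t‖ ≤ K * ((Fintype.card ι * M) ^ n / n !) * |t - c| ^ n := by
  induction n with
  | zero => intro i t _; simpa [picardTerm] using hK i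
  | succ n ih =>
    intro i t ht
    have hsub : uIoc c t ⊆ Icc a b :=
      uIoc_subset_uIcc.trans (Set.OrdConnected.uIcc_subset inferInstance hc ht)
    refine (norm_integral_le_pow
      (L := Fintype.card ι * M * (K * ((Fintype.card ι * M) ^ n / n !))) (n := n)
      fun s hs => ?_).trans (le_of_eq ?_)
    · have hs' := hsub hs
      calc ‖∑ j, B i j s * picardTerm B c y₀ n j s‖
          ≤ ∑ j : ι, M * (K * ((Fintype.card ι * M) ^ n / n !) * |s - c| ^ n) := by
            refine norm_sum_le_of_le _ fun j _ => ?_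
            rw [norm_mul]
            exact mul_le_mul (hM i j s hs') (ih j s hs') (norm_nonneg _)
              ((norm_nonneg _).trans (hM i j s hs'))
        _ = _ := by simp only [Finset.sum_const, Finset.card_univ, nsmul_eq_mul]; ring
    · rw [Nat.factorial_succ]
      push_cast
      field_simp
      ring

theorem exists_forall_norm_le {I : Set ℝ} {B : ι → ι → ℝ → ℂ}
    (hB : ∀ i j, ContinuousOn (B i j) I) {a b : ℝ} (hab : Icc a b ⊆ I) :
    ∃ M, ∀ i j, ∀ t ∈ Icc a b, ‖B i j t‖ ≤ M := by
  have h : ∀ p : ι × ι, ∃ M, ∀ t ∈ Icc a b, ‖B p.1 p.2 t‖ ≤ M := fun p =>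
    isCompact_Icc.exists_bound_of_continuousOn ((hB p.1 p.2).mono hab)
  choose M hM using h
  obtain ⟨K, hK⟩ := Finite.exists_le M
  exact ⟨K, fun i j t ht => (hM (i, j) t ht).trans (hK _)⟩

/-- Linear differential equations with continuous coefficients have solutions on the whole
interval. -/
theorem exists_linear_ode {I : Set ℝ} [I.OrdConnected] {B : ι → ι → ℝ → ℂ}
    (hB : ∀ i j, ContinuousOn (B i j) I) {c : ℝ} (hc : c ∈ I) (y₀ : ι → ℂ) :
    ∃ y : ι → ℝ → ℂ, (∀ i, y i c = y₀ i) ∧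
      ∀ i, ∀ t ∈ I, HasDerivWithinAt (y i) (∑ j, B i j t * y j t) I t := by
  set P := picardTerm B c y₀ with hP
  obtain ⟨K, hK⟩ := Finite.exists_le fun i => ‖y₀ i‖
  -- On each compact subinterval, the series is dominated by an exponential series.
  have bound : ∀ a b, Icc a b ⊆ I → c ∈ Icc a b → ∃ u : ℕ → ℝ, Summable u ∧
      ∀ n i, ∀ t ∈ Icc a b, ‖P n i t‖ ≤ u n := by
    intro a b hab hcab
    obtain ⟨M, hM⟩ := exists_forall_norm_le hB hab
    refine ⟨fun n => |K| * ((Fintype.card ι * |M| * (b - a)) ^ n / n !),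
      (Real.summable_pow_div_factorial _).mul_left _, fun n i t ht => ?_⟩
    refine (norm_picardTerm_le hcab (fun i j t ht => (hM i j t ht).trans (le_abs_self M))
      (fun i => (hK i).trans (le_abs_self K)) n i t ht).trans ?_
    rw [mul_assoc, div_mul_eq_mul_div, ← mul_pow]
    have : |t - c| ≤ b - a := abs_sub_le_iff.2
      ⟨by linarith [ht.2, hcab.1], by linarith [ht.1, hcab.2]⟩
    beta_reduce
    gcongr
  have hcont : ∀ n i, ContinuousOn (P n i) I := fun n i => continuousOn_picardTerm hB hc y₀ n i
  have hy : ∀ i, ContinuousOn (fun t => ∑' n, P n i t) I := by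
    intro i t ht
    obtain ⟨a, ha, b, hb, hab, hc', ht', hn⟩ := exists_Icc_mem_nhdsWithin I hc ht
    have hs : Icc a b ⊆ I := Set.Icc_subset I ha hb
    obtain ⟨u, hu, hPu⟩ := bound a b hs hc'
    exact ((continuousOn_tsum (fun n => (hcont n i).mono hs) hu
      fun n t ht => hPu n i t ht) t ht').mono_of_mem_nhdsWithin hn
  have hint : ∀ i, ∀ t ∈ I,
      ∑' n, P n i t = y₀ i + ∫ s in c..t, ∑ j, B i j s * ∑' n, P n j s := by
    intro i t ht
    obtain ⟨a, ha, b, hb, hab, hc', ht', -⟩ := exists_Icc_mem_nhdsWithin I hc ht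
    have hs : Icc a b ⊆ I := Set.Icc_subset I ha hb
    obtain ⟨u, hu, hPu⟩ := bound a b hs hc'
    obtain ⟨M, hM⟩ := exists_forall_norm_le hB hs
    have hct : uIcc c t ⊆ Icc a b := Set.OrdConnected.uIcc_subset inferInstance hc' ht'
    have hsum : HasSum (fun n => P (n + 1) i t) (∫ s in c..t, ∑ j, B i j s * ∑' n, P n j s) := by
      refine intervalIntegral.hasSum_integral_of_dominated_convergence
        (fun n _ => ∑ _j : ι, M * u n) (fun n => ?_) (fun n => ?_) ?_ ?_ ?_
      · refine ContinuousOn.aestronglyMeasurable ?_ measurableSet_uIoc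
        exact (continuousOn_finsetSum _ fun j _ => (hB i j).mul (hcont n j)).mono
          (uIoc_subset_uIcc.trans (hct.trans hs))
      · refine Eventually.of_forall fun s hs' => norm_sum_le_of_le _ fun j _ => ?_
        have h := hct (uIoc_subset_uIcc hs')
        rw [norm_mul]
        exact mul_le_mul (hM i j s h) (hPu n j s h) (norm_nonneg _)
          ((norm_nonneg _).trans (hM i j s h))
      · exact Eventually.of_forall fun s _ => summable_sum fun j _ => hu.mul_left M
      · exact intervalIntegrable_const
      · refine Eventually.of_forall fun s hs' => hasSum_sum fun j _ => HasSum.mul_left _ ?_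
        have h := hct (uIoc_subset_uIcc hs')
        exact (Summable.of_norm_bounded hu fun n => hPu n j s h).hasSum
    rw [(Summable.of_norm_bounded hu fun n => hPu n i t ht').tsum_eq_zero_add, hsum.tsum_eq]
    rfl
  refine ⟨fun i t => ∑' n, P n i t, fun i => ?_, fun i t ht => ?_⟩
  · exact (hint i c hc).trans (by simp)
  · exact ((hasDerivWithinAt_integral (continuousOn_finsetSum _ fun j _ =>
      (hB i j).mul (hy j)) hc ht).const_add (y₀ i)).congr_of_mem (fun s hs => hint i s hs) ht

/-- Solutions of linear differential equations with smooth coefficients are smooth. -/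
theorem contDiffOn_of_linear_ode {I : Set ℝ} [I.OrdConnected] [Nontrivial I]
    {B : ι → ι → ℝ → ℂ} (hB : ∀ i j, ContDiffOn ℝ ∞ (B i j) I) {y : ι → ℝ → ℂ}
    (hy : ∀ i, ∀ t ∈ I, HasDerivWithinAt (y i) (∑ j, B i j t * y j t) I t) (i : ι) :
    ContDiffOn ℝ ∞ (y i) I := by
  have hI := uniqueDiffOn_interval I
  refine contDiffOn_infty.2 fun n => ?_
  induction n generalizing i with
  | zero => exact contDiffOn_zero.2 fun t ht => (hy i t ht).continuousWithinAt
  | succ n ih =>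
    have : ((n + 1 : ℕ) : WithTop ℕ∞) = n + 1 := by push_cast; rfl
    rw [this, contDiffOn_succ_iff_derivWithin hI]
    refine ⟨fun t ht => (hy i t ht).differentiableWithinAt, by simp, ?_⟩
    have h : ContDiffOn ℝ n (fun t => ∑ j, B i j t * y j t) I :=
      ContDiffOn.sum fun j _ => ((hB i j).of_le (by exact_mod_cast le_top)).mul (ih j)
    exact h.congr fun t ht => (hy i t ht).derivWithin (hI t ht)

end LinearODE

section Fundamental

open Set

variable {I : Set ℝ} [I.OrdConnected] [Nontrivial I]

/-- A linear differential equation `Φ' = B Φ` with smooth coefficients has a fundamental matrix `Φ`,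
with inverse `Ψ`, on the whole interval. -/
theorem exists_fundamental_matrix {m : ℕ} (B : Matrix (Fin m) (Fin m) (SmoothFn I)) :
    ∃ Φ Ψ : Matrix (Fin m) (Fin m) (SmoothFn I),
      (∀ t ∈ I, ∀ i j, ∑ k, (Φ i k : ℝ → ℂ) t * (Ψ k j : ℝ → ℂ) t = if i = j then 1 else 0) ∧
      (∀ t ∈ I, ∀ i j, HasDerivWithinAt (Φ i j : ℝ → ℂ)
        (∑ k, (B i k : ℝ → ℂ) t * (Φ k j : ℝ → ℂ) t) I t) ∧
      (∀ t ∈ I, ∀ i j, HasDerivWithinAt (Ψ i j : ℝ → ℂ)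
        (-∑ k, (Ψ i k : ℝ → ℂ) t * (B k j : ℝ → ℂ) t) I t) := by
  have hc := basePoint_mem I
  have hB : ∀ i j, ContDiffOn ℝ ∞ (B i j : ℝ → ℂ) I := fun i j => (B i j).2
  -- `Φ j` is the `j`th column of the solution, and `Ψ i` the `i`th row of its inverse.
  have h1 := fun j : Fin m => exists_linear_ode (B := fun i k => (B i k : ℝ → ℂ))
    (fun i k => (hB i k).continuousOn) hc (fun i => if i = j then 1 else 0)
  have h2 := fun i : Fin m => exists_linear_ode (B := fun j k => -(B k j : ℝ → ℂ))
    (fun j k => (hB k j).continuousOn.neg) hc (fun j => if i = j then 1 else 0)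
  choose Φ hΦ0 hΦ using h1
  choose Ψ hΨ0 hΨ using h2
  have sΦ : ∀ j i, ContDiffOn ℝ ∞ (Φ j i) I := fun j => contDiffOn_of_linear_ode hB (hΦ j)
  have sΨ : ∀ i j, ContDiffOn ℝ ∞ (Ψ i j) I := fun i =>
    contDiffOn_of_linear_ode (fun j k => (hB k j).neg) (hΨ i)
  have dΨ : ∀ t ∈ I, ∀ i j, HasDerivWithinAt (Ψ i j)
      (-∑ k, Ψ i k t * (B k j : ℝ → ℂ) t) I t := by
    intro t ht i j
    refine (hΨ i j t ht).congr_deriv ?_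
    simp [mul_comm]
  have key : ∀ t ∈ I, (Matrix.of fun i j => Ψ i j t) * (Matrix.of fun i j => Φ j i t) = 1 := by
    intro t ht
    ext i j
    have hd : ∀ s ∈ I, HasDerivWithinAt (fun s => ∑ k, Ψ i k s * Φ j k s) 0 I s := by
      intro s hs
      refine (HasDerivWithinAt.fun_sum fun k _ =>
        (dΨ s hs i k).mul (hΦ j k s hs)).congr_deriv ?_
      simp only [Finset.sum_add_distrib, neg_mul, Finset.sum_mul, Finset.mul_sum,
        Finset.sum_neg_distrib]
      rw [Finset.sum_comm, neg_add_eq_zero]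
      simp only [mul_assoc]
    have := eqOn_const_of_hasDerivWithinAt_zero (convex_interval I) hd ht hc
    simp only [hΦ0, hΨ0] at this
    simpa [Matrix.mul_apply, Matrix.one_apply] using this
  refine ⟨Matrix.of fun i j => ⟨Φ j i, sΦ j i⟩, Matrix.of fun i j => ⟨Ψ i j, sΨ i j⟩, ?_, ?_, ?_⟩
  · intro t ht i j
    have h := mul_eq_one_comm.1 (key t ht)
    have := congrFun₂ h i j
    simpa [Matrix.mul_apply, Matrix.one_apply] using this
  · exact fun t ht i j => hΦ j i t ht
  · exact dΨ

end Fundamental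

/-! ### The calculus of distributions and their kernels -/

section Kernels

open MeasureTheory Set Filter Topology

open scoped TensorProduct

variable {I : Set ℝ} [I.OrdConnected] [Nontrivial I]

/-- The differential equations for a fundamental matrix, read as identities between multiplication
operators. -/
theorem map_mulOp_fundamental {m : ℕ} {B Φ Ψ : Matrix (Fin m) (Fin m) (SmoothFn I)}
    (h1 : ∀ t ∈ I, ∀ i j,
      ∑ k, (Φ i k : ℝ → ℂ) t * (Ψ k j : ℝ → ℂ) t = if i = j then 1 else 0)
    (h2 : ∀ t ∈ I, ∀ i j, HasDerivWithinAt (Φ i j : ℝ → ℂ)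
      (∑ k, (B i k : ℝ → ℂ) t * (Φ k j : ℝ → ℂ) t) I t)
    (h3 : ∀ t ∈ I, ∀ i j, HasDerivWithinAt (Ψ i j : ℝ → ℂ)
      (-∑ k, (Ψ i k : ℝ → ℂ) t * (B k j : ℝ → ℂ) t) I t) :
    Φ.map (mulOp I) * Ψ.map (mulOp I) = 1 ∧
      (Φ.map (derivFn I)).map (mulOp I) = B.map (mulOp I) * Φ.map (mulOp I) ∧
      (Ψ.map (derivFn I)).map (mulOp I) = -(Ψ.map (mulOp I) * B.map (mulOp I)) := by
  refine ⟨?_, ?_, ?_⟩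
  · ext i j φ s
    by_cases hs : s ∈ I
    · have := h1 s hs i j
      simp only [Matrix.mul_apply, Matrix.map_apply, ← map_mul, ← map_sum]
      rw [mulOp_apply]
      by_cases hij : i = j <;> simp_all [Matrix.one_apply]
    · rw [TestSpace.eq_zero_of_notMem _ hs, TestSpace.eq_zero_of_notMem _ hs]
  · ext1 i j
    simp only [Matrix.mul_apply, Matrix.map_apply, ← map_mul, ← map_sum]
    refine mulOp_congr fun s hs => ?_
    rw [derivFn_apply_of_hasDerivWithinAt hs (h2 s hs i j)]
    simp
  · ext1 i j
    simp only [Matrix.mul_apply, Matrix.map_apply, Matrix.neg_apply, ← map_mul, ← map_sum]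
    refine (mulOp_congr fun s hs => ?_).trans (map_neg (mulOp I) _)
    rw [derivFn_apply_of_hasDerivWithinAt hs (h3 s hs i j)]
    simp

/-- The calculus of the distributions on the interval `I`: the operator `D` is `δ'`, and its inverse
is the Heaviside distribution. -/
noncomputable def volterra (I : Set ℝ) [I.OrdConnected] [Nontrivial I] :
    VolterraCalculus (StarAlgebra I) (SmoothFn I) where
  mulOp := mulOp I
  D := deltaUnit I
  deriv := derivFn I
  integral := integralFn I
  leibniz := deltaDist_one_mul_mulOp
  mulOp_deriv_integral f := mulOp_congr fun _ hs => derivFn_integralFn f hs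
  exists_fundamental m B := by
    obtain ⟨Φ, Ψ, h1, h2, h3⟩ := exists_fundamental_matrix B
    exact ⟨Φ, Ψ, map_mulOp_fundamental h1 h2 h3⟩

/-- The value at `(s, t)` of the separable kernel `∑ g(s) h(t)`, for `∑ g ⊗ h`. -/
noncomputable def evalKernel (I : Set ℝ) (s t : ℝ) : SmoothFn I ⊗[ℂ] SmoothFn I →ₗ[ℂ] ℂ :=
  LinearMap.mul' ℂ ℂ ∘ₗ TensorProduct.map (LinearMap.proj s ∘ₗ (SmoothFn I).val.toLinearMap)
    (LinearMap.proj t ∘ₗ (SmoothFn I).val.toLinearMap)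

@[simp] theorem evalKernel_tmul {I : Set ℝ} (s t : ℝ) (g h : SmoothFn I) :
    evalKernel I s t (g ⊗ₜ h) = (g : ℝ → ℂ) s * (h : ℝ → ℂ) t := rfl

theorem evalKernel_self {I : Set ℝ} (t : ℝ) (z : SmoothFn I ⊗[ℂ] SmoothFn I) :
    evalKernel I t t z = (LinearMap.mul' ℂ (SmoothFn I) z : ℝ → ℂ) t := by
  induction z with
  | zero => simp
  | tmul g h => simp
  | add z w hz hw => simp [hz, hw]

/-- The separable kernel `∑ g(t') h(t)`, for `∑ g ⊗ h`. -/
noncomputable def sepKernel {I : Set ℝ} (z : SmoothFn I ⊗[ℂ] SmoothFn I) : SmoothKernel I where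
  toFun s t := evalKernel I s t z
  smooth := by
    induction z with
    | zero => simpa [Function.uncurry_def] using contDiffOn_const
    | tmul g h =>
      have hg : ContDiffOn ℝ ∞ (g : ℝ → ℂ) I := g.2
      have hh : ContDiffOn ℝ ∞ (h : ℝ → ℂ) I := h.2
      exact (hg.comp contDiffOn_fst fun p (hp : p ∈ I ×ˢ I) => hp.1).mul
        (hh.comp contDiffOn_snd fun p (hp : p ∈ I ×ˢ I) => hp.2)
    | add z w hz hw => simpa [Function.uncurry_def] using hz.add hw

theorem dist_sepKernel (z : SmoothFn I ⊗[ℂ] SmoothFn I) :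
    (sepKernel z).dist = (volterra I).sep z := by
  refine LinearMap.ext fun φ => TestSpace.ext_on fun s hs => ?_
  rw [SmoothKernel.dist_apply _ _ hs]
  induction z with
  | zero => simp [sepKernel]
  | tmul g h =>
    rw [VolterraCalculus.sep_tmul]
    change ∫ t in Iic s, evalKernel I s t (g ⊗ₜ h) * (φ : ℝ → ℂ) t
      = (g : ℝ → ℂ) s * (thetaDist I (mulOp I h φ) : ℝ → ℂ) s
    rw [thetaDist_apply _ hs, ← integral_const_mul]
    simp [mul_assoc]
  | add z w hz hw =>
    rw [map_add]
    refine Eq.trans ?_ (congrArg₂ (· + ·) hz hw)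
    refine Eq.trans ?_ (integral_add (kernel_integrand_integrableOn I (sepKernel z) φ hs)
      (kernel_integrand_integrableOn I (sepKernel w) φ hs))
    simp [sepKernel, add_mul]

theorem hasDerivWithinAt_evalKernel_left {s : ℝ} (hs : s ∈ I) (t : ℝ)
    (z : SmoothFn I ⊗[ℂ] SmoothFn I) : HasDerivWithinAt (fun s => evalKernel I s t z)
      (evalKernel I s t (LinearMap.rTensor _ (derivFn I) z)) I s := by
  induction z with
  | zero => simpa using hasDerivWithinAt_const s I (0 : ℂ)
  | tmul g h => simpa using (hasDerivWithinAt_derivFn g hs).mul_const _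
  | add z w hz hw => simpa using hz.fun_add hw

theorem hasDerivWithinAt_evalKernel_right (s : ℝ) {t : ℝ} (ht : t ∈ I)
    (z : SmoothFn I ⊗[ℂ] SmoothFn I) : HasDerivWithinAt (fun t => evalKernel I s t z)
      (evalKernel I s t (LinearMap.lTensor _ (derivFn I) z)) I t := by
  induction z with
  | zero => simpa using hasDerivWithinAt_const t I (0 : ℂ)
  | tmul g h => simpa using (hasDerivWithinAt_derivFn h ht).const_mul _
  | add z w hz hw => simpa using hz.fun_add hw

theorem derivFn_one {t : ℝ} (ht : t ∈ I) : (derivFn I 1 : ℝ → ℂ) t = 0 :=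
  derivFn_apply_of_hasDerivWithinAt ht (hasDerivWithinAt_const t I (1 : ℂ))

theorem derivFn_mul (f g : SmoothFn I) {t : ℝ} (ht : t ∈ I) : (derivFn I (f * g) : ℝ → ℂ) t
    = (derivFn I f : ℝ → ℂ) t * (g : ℝ → ℂ) t + (f : ℝ → ℂ) t * (derivFn I g : ℝ → ℂ) t :=
  derivFn_apply_of_hasDerivWithinAt ht
    ((hasDerivWithinAt_derivFn f ht).mul (hasDerivWithinAt_derivFn g ht))

theorem evalKernel_sepIntegral_self (t : ℝ) (z : SmoothFn I ⊗[ℂ] SmoothFn I) :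
    evalKernel I t t ((volterra I).sepIntegral z) = 0 := by
  rw [evalKernel_self, VolterraCalculus.mul'_sepIntegral]
  rfl

/-- A shortcut instance, which the general search finds too slowly. -/
noncomputable instance instAddCommGroupSmoothFnTensor :
    AddCommGroup (SmoothFn I ⊗[ℂ] SmoothFn I) := TensorProduct.addCommGroup

/-- The derivative in `t'` of `Θ * z` at the diagonal is the diagonal value of `z`. -/
theorem evalKernel_rTensor_sepIntegral {t : ℝ} (ht : t ∈ I) (z : SmoothFn I ⊗[ℂ] SmoothFn I) :
    evalKernel I t t (LinearMap.rTensor _ (derivFn I) ((volterra I).sepIntegral z))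
      = (LinearMap.mul' ℂ (SmoothFn I) z : ℝ → ℂ) t := by
  induction z with
  | zero => simp
  | tmul g h =>
    rw [VolterraCalculus.sepIntegral_tmul]
    change evalKernel I t t (LinearMap.rTensor _ (derivFn I)
      (integralFn I g ⊗ₜ h - 1 ⊗ₜ (integralFn I g * h))) = _
    simp [derivFn_integralFn g ht, derivFn_one ht]
  | add z w hz hw => simp [hz, hw]

/-- The derivative in `t` of `Θ * z` at the diagonal is minus the diagonal value of `z`. -/
theorem evalKernel_lTensor_sepIntegral {t : ℝ} (ht : t ∈ I) (z : SmoothFn I ⊗[ℂ] SmoothFn I) :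
    evalKernel I t t (LinearMap.lTensor _ (derivFn I) ((volterra I).sepIntegral z))
      = -(LinearMap.mul' ℂ (SmoothFn I) z : ℝ → ℂ) t := by
  induction z with
  | zero => simp
  | tmul g h =>
    rw [VolterraCalculus.sepIntegral_tmul]
    change evalKernel I t t (LinearMap.lTensor _ (derivFn I)
      (integralFn I g ⊗ₜ h - 1 ⊗ₜ (integralFn I g * h))) = _
    simp [derivFn_integralFn g ht, derivFn_mul _ _ ht]
  | add z w hz hw => simp [hz, hw, add_comm]

theorem exists_kernel_of_order_one {x : StarAlgebra I} {f : SmoothFn I}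
    (hx : (volterra I).HasSymbol 1 x f) : ∃ k : SmoothKernel I, k.dist = x := by
  obtain ⟨z, hz, -⟩ := hx.exists_sep
  exact ⟨sepKernel z, (dist_sepKernel z).trans hz⟩

/-- The kernel of an operator of order `2` vanishes on the diagonal, and its derivatives there are
`±` the symbol. -/
theorem exists_kernel_of_order_two {x : StarAlgebra I} {f : SmoothFn I}
    (hx : (volterra I).HasSymbol 2 x f) : ∃ k : SmoothKernel I, k.dist = x ∧ ∀ t ∈ I,
      k t t = 0 ∧ derivWithin (fun s => k s t) I t = (f : ℝ → ℂ) t ∧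
      derivWithin (fun s => k t s) I t = -(f : ℝ → ℂ) t := by
  obtain ⟨z, hz, hf⟩ := hx.exists_sep_sepIntegral
  refine ⟨sepKernel ((volterra I).sepIntegral z), (dist_sepKernel _).trans hz, fun t ht =>
    ⟨evalKernel_sepIntegral_self t z, ?_, ?_⟩⟩
  · rw [← hf, ← evalKernel_rTensor_sepIntegral ht]
    exact (hasDerivWithinAt_evalKernel_left ht t _).derivWithin (uniqueDiffOn_interval I t ht)
  · rw [← hf, ← evalKernel_lTensor_sepIntegral ht]
    exact (hasDerivWithinAt_evalKernel_right t ht _).derivWithin (uniqueDiffOn_interval I t ht)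

end Kernels

/-! ### Powers and Neumann series of Volterra operators -/

section Neumann

open MeasureTheory Set Filter Topology

variable {I : Set ℝ} [I.OrdConnected] [Nontrivial I]

theorem SmoothKernel.dist_apply_eq_intervalIntegral (f : SmoothKernel I) {φ : TestSpace I}
    {c s : ℝ} (hφ : ∀ t ≤ c, (φ : ℝ → ℂ) t = 0) (hs : s ∈ I) :
    (f.dist φ : ℝ → ℂ) s = ∫ t in c..s, f s t * (φ : ℝ → ℂ) t := by
  rw [f.dist_apply φ hs, setIntegral_Iic_eq_intervalIntegral fun t ht => by rw [hφ t ht, mul_zero]]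

theorem SmoothKernel.dist_apply_eq_zero (f : SmoothKernel I) {φ : TestSpace I}
    {c : ℝ} (hφ : ∀ t ≤ c, (φ : ℝ → ℂ) t = 0) {s : ℝ} (hs : s ≤ c) :
    (f.dist φ : ℝ → ℂ) s = 0 := by
  by_cases hsI : s ∈ I
  · rw [f.dist_apply φ hsI]
    exact setIntegral_eq_zero_of_forall_eq_zero fun t ht => by rw [hφ t (le_trans ht hs), mul_zero]
  · exact TestSpace.eq_zero_of_notMem _ hsI

variable {N : ℕ}

/-- The matrix of distributions with given smooth kernels. -/
noncomputable def distMatrix (F : Fin N → Fin N → SmoothKernel I) :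
    Matrix (Fin N) (Fin N) (StarAlgebra I) :=
  Matrix.of fun i j => (F i j).dist

theorem matrix_mul_apply_apply (X Y : Matrix (Fin N) (Fin N) (StarAlgebra I)) (i j : Fin N)
    (φ : TestSpace I) (s : ℝ) :
    ((X * Y) i j φ : ℝ → ℂ) s = ∑ k, (X i k (Y k j φ) : ℝ → ℂ) s := by
  rw [Matrix.mul_apply, LinearMap.sum_apply, Submodule.coe_sum, Finset.sum_apply]
  rfl

/-- The powers of a matrix of Volterra operators decay like the terms of the exponential series. -/
theorem exists_norm_distMatrix_pow_le (F : Fin N → Fin N → SmoothKernel I) (φ : TestSpace I)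
    (t : ℝ) : ∃ K x : ℝ, ∀ n i j,
      ‖((distMatrix F ^ n) i j φ : ℝ → ℂ) t‖ ≤ K * (x ^ n / n.factorial) := by
  by_cases ht : t ∈ I
  swap
  · exact ⟨0, 0, fun n i j => by rw [TestSpace.eq_zero_of_notMem _ ht]; simp⟩
  obtain ⟨c, hc, h3⟩ := φ.2.2.2
  have hcI : c ∈ I := interior_subset hc
  have hz : ∀ n i j, ∀ s ≤ c, ((distMatrix F ^ n) i j φ : ℝ → ℂ) s = 0 := by
    intro n
    induction n with
    | zero =>
      intro i j s hs
      rw [pow_zero, Matrix.one_apply]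
      split_ifs
      · exact h3 s hs
      · rfl
    | succ n ih =>
      intro i j s hs
      rw [pow_succ', matrix_mul_apply_apply]
      exact Finset.sum_eq_zero fun k _ => (F i k).dist_apply_eq_zero (ih k j) hs
  rcases le_total t c with htc | htc
  · exact ⟨0, 0, fun n i j => by rw [hz n i j t htc]; simp⟩
  have hsub : Icc c t ⊆ I := Set.Icc_subset I hcI ht
  obtain ⟨K, hK⟩ := isCompact_Icc.exists_bound_of_continuousOn (φ.2.1.continuousOn.mono hsub)
  have hF : ∀ p : Fin N × Fin N, ∃ M, ∀ q ∈ Icc c t ×ˢ Icc c t,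
      ‖Function.uncurry (F p.1 p.2) q‖ ≤ M := fun p =>
    (isCompact_Icc.prod isCompact_Icc).exists_bound_of_continuousOn
      ((F p.1 p.2).smooth.continuousOn.mono (prod_mono hsub hsub))
  choose M' hM' using hF
  obtain ⟨M, hM⟩ := Finite.exists_le M'
  have hMb : ∀ i j, ∀ s ∈ Icc c t, ∀ r ∈ Icc c t, ‖F i j s r‖ ≤ M := fun i j s hs r hr =>
    (hM' (i, j) (s, r) ⟨hs, hr⟩).trans (hM _)
  have key : ∀ n i j, ∀ s ∈ Icc c t, ‖((distMatrix F ^ n) i j φ : ℝ → ℂ) s‖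
      ≤ K * ((N * M) ^ n / n.factorial) * |s - c| ^ n := by
    intro n
    induction n with
    | zero =>
      intro i j s hs
      have h0 := hK s hs
      rw [pow_zero, Matrix.one_apply]
      split_ifs
      · simpa using h0
      · simpa using (norm_nonneg _).trans h0
    | succ n ih =>
      intro i j s hs
      rw [pow_succ', matrix_mul_apply_apply]
      calc _ ≤ ∑ _k : Fin N,
            M * (K * ((N * M) ^ n / n.factorial)) * (|s - c| ^ (n + 1) / (n + 1)) := by
            refine norm_sum_le_of_le _ fun k _ => ?_
            refine (congrArg norm
              ((F i k).dist_apply_eq_intervalIntegral (hz n k j) (hsub hs))).trans_le ?_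
            refine norm_integral_le_pow fun r hr => ?_
            rw [uIoc_of_le hs.1] at hr
            have hr' : r ∈ Icc c t := ⟨hr.1.le, hr.2.trans hs.2⟩
            rw [norm_mul, mul_assoc M]
            exact mul_le_mul (hMb i k s hs r hr') (ih k j r hr') (norm_nonneg _)
              ((norm_nonneg _).trans (hMb i k s hs r hr'))
        _ = _ := by
          simp only [Finset.sum_const, Finset.card_univ, Fintype.card_fin, nsmul_eq_mul]
          rw [Nat.factorial_succ]
          push_cast
          field_simp
          ring
  refine ⟨K, N * M * |t - c|, fun n i j => (key n i j t ⟨htc, le_rfl⟩).trans (le_of_eq ?_)⟩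
  rw [mul_pow _ |t - c|]
  ring

theorem summable_distMatrix_pow (F : Fin N → Fin N → SmoothKernel I) (φ : TestSpace I)
    (t : ℝ) (i j : Fin N) : Summable fun n => ((distMatrix F ^ n) i j φ : ℝ → ℂ) t := by
  obtain ⟨K, x, h⟩ := exists_norm_distMatrix_pow_le F φ t
  exact Summable.of_norm_bounded ((Real.summable_pow_div_factorial x).mul_left K)
    fun n => h n i j

/-- An idempotent matrix of Volterra operators vanishes, because its powers tend to zero. -/
theorem distMatrix_eq_zero_of_idempotent (F : Fin N → Fin N → SmoothKernel I)
    (h : distMatrix F * distMatrix F = distMatrix F) : distMatrix F = 0 := by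
  have hp : ∀ n, distMatrix F ^ (n + 1) = distMatrix F := by
    intro n
    induction n with
    | zero => rw [zero_add, pow_one]
    | succ n ih => rw [pow_succ, ih, h]
  ext i j φ t
  have h1 := (summable_distMatrix_pow F φ t i j).tendsto_atTop_zero.comp (tendsto_add_atTop_nat 1)
  simp only [Function.comp_def, hp] at h1
  exact tendsto_nhds_unique tendsto_const_nhds h1

/-- The remainder of the geometric series of `a`, for `r = (1 - a)⁻¹`. -/
theorem sum_pow_add_pow_mul {S : Type*} [Semiring S] {a r : S} (h : r = 1 + a * r) (n : ℕ) :
    ∑ k ∈ Finset.range n, a ^ k + a ^ n * r = r := by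
  induction n with
  | zero => simp
  | succ n ih =>
    rw [Finset.sum_range_succ, add_assoc]
    nth_rewrite 2 [← ih]
    congr 1
    nth_rewrite 2 [h]
    rw [mul_add, mul_one, pow_succ, mul_assoc]

/-- The Neumann series of a matrix of Volterra operators converges pointwise to the resolvent. -/
theorem hasSum_distMatrix_pow (F : Fin N → Fin N → SmoothKernel I)
    {R : Matrix (Fin N) (Fin N) (StarAlgebra I)} (h : R = 1 + distMatrix F * R) (φ : TestSpace I)
    (t : ℝ) (i j : Fin N) :
    HasSum (fun n => ((distMatrix F ^ n) i j φ : ℝ → ℂ) t) ((R i j φ : ℝ → ℂ) t) := by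
  refine ((summable_distMatrix_pow F φ t i j).hasSum_iff_tendsto_nat).2 ?_
  have h1 : Tendsto (fun n => ∑ k, ((distMatrix F ^ n) i k (R k j φ) : ℝ → ℂ) t) atTop (𝓝 0) := by
    rw [← Finset.sum_const_zero (s := (Finset.univ : Finset (Fin N)))]
    exact tendsto_finsetSum _ fun k _ =>
      (summable_distMatrix_pow F (R k j φ) t i k).tendsto_atTop_zero
  have h2 := (tendsto_const_nhds (x := (R i j φ : ℝ → ℂ) t)).sub h1
  rw [sub_zero] at h2
  refine h2.congr fun n => ?_
  have h3 := congrArg (fun X : Matrix (Fin N) (Fin N) (StarAlgebra I) => (X i j φ : ℝ → ℂ) t)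
    (sum_pow_add_pow_mul h n)
  simp only [Matrix.add_apply, LinearMap.add_apply, Submodule.coe_add, Pi.add_apply,
    matrix_mul_apply_apply, Matrix.sum_apply, LinearMap.sum_apply, Submodule.coe_sum,
    Finset.sum_apply] at h3
  rw [← h3, add_sub_cancel_right]

end Neumann

/-! ### The Lanczos algorithm over a noncommutative ring -/

section NoncommutativeLanczos

variable {R : Type*} [Ring R] {N : ℕ}

/-- The variables of the Lanczos algorithm over a noncommutative ring after `k` iterations: the
rows `w_{k-1}`, `w_k`, the columns `v_{k-1}`, `v_k` and the coefficient `β_k`. -/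
structure RingLanczosState (R : Type*) (N : ℕ) where
  wPrev : Fin N → R
  wCur : Fin N → R
  vPrev : Fin N → R
  vCur : Fin N → R
  beta : R

/-- The coefficient `α_k = w_k A v_k`. -/
def RingLanczosState.alpha (A : Matrix (Fin N) (Fin N) R) (s : RingLanczosState R N) : R :=
  s.wCur ⬝ᵥ (A *ᵥ s.vCur)

/-- The column `v̂_{k+1} = A v_k - v_k α_k - v_{k-1}`. -/
def RingLanczosState.vHat (A : Matrix (Fin N) (Fin N) R) (s : RingLanczosState R N) : Fin N → R :=
  A *ᵥ s.vCur - (fun i => s.vCur i * s.alpha A) - s.vPrev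

/-- The non-Hermitian Lanczos algorithm over a noncommutative ring. Columns are multiplied by
coefficients from the right; the inverse of a coefficient that is not a unit is `0` by
convention. -/
noncomputable def ringLanczos (A : Matrix (Fin N) (Fin N) R) (w v : Fin N → R) :
    ℕ → RingLanczosState R N
  | 0 => ⟨0, w, 0, v, 0⟩
  | k + 1 =>
    let s := ringLanczos A w v k
    let w' : Fin N → R := s.wCur ᵥ* A - s.alpha A • s.wCur - s.beta • s.wPrev
    ⟨s.wCur, w', s.vCur, fun i => s.vHat A i * Ring.inverse (w' ⬝ᵥ s.vHat A), w' ⬝ᵥ s.vHat A⟩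

theorem dotProduct_mul_right (x y : Fin N → R) (a : R) :
    x ⬝ᵥ (fun i => y i * a) = (x ⬝ᵥ y) * a := by
  simp [dotProduct, Finset.sum_mul, mul_assoc]

section

variable (A : Matrix (Fin N) (Fin N) R) (w v : Fin N → R)

theorem wCur_succ_dotProduct (k : ℕ) (y : Fin N → R) :
    (ringLanczos A w v (k + 1)).wCur ⬝ᵥ y = (ringLanczos A w v k).wCur ⬝ᵥ (A *ᵥ y)
      - (ringLanczos A w v k).alpha A * ((ringLanczos A w v k).wCur ⬝ᵥ y)
      - (ringLanczos A w v k).beta * ((ringLanczos A w v k).wPrev ⬝ᵥ y) := by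
  simp [ringLanczos, sub_dotProduct, smul_dotProduct, Matrix.dotProduct_mulVec]

theorem dotProduct_vHat (k : ℕ) (x : Fin N → R) :
    x ⬝ᵥ (ringLanczos A w v k).vHat A = x ⬝ᵥ (A *ᵥ (ringLanczos A w v k).vCur)
      - (x ⬝ᵥ (ringLanczos A w v k).vCur) * (ringLanczos A w v k).alpha A
      - x ⬝ᵥ (ringLanczos A w v k).vPrev := by
  simp [RingLanczosState.vHat, dotProduct_sub, dotProduct_mul_right]

theorem dotProduct_vCur_succ (k : ℕ) (x : Fin N → R) :
    x ⬝ᵥ (ringLanczos A w v (k + 1)).vCur = (x ⬝ᵥ (ringLanczos A w v k).vHat A)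
      * Ring.inverse (ringLanczos A w v (k + 1)).beta :=
  dotProduct_mul_right _ _ _

theorem dotProduct_vHat_eq {k : ℕ} (h : IsUnit (ringLanczos A w v (k + 1)).beta) (x : Fin N → R) :
    x ⬝ᵥ (ringLanczos A w v k).vHat A
      = (x ⬝ᵥ (ringLanczos A w v (k + 1)).vCur) * (ringLanczos A w v (k + 1)).beta := by
  rw [dotProduct_vCur_succ, mul_assoc, Ring.inverse_mul_cancel _ h, mul_one]

/-- If the first `n` coefficients `β` are units, then the first `n + 1` rows and columns are
biorthogonal. -/
theorem ringLanczos_biorthogonal (hwv : w ⬝ᵥ v = 1) (n : ℕ)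
    (hβ : ∀ k < n, IsUnit (ringLanczos A w v (k + 1)).beta) :
    (∀ i ≤ n, ∀ j ≤ n, (ringLanczos A w v i).wCur ⬝ᵥ (ringLanczos A w v j).vCur
      = if i = j then 1 else 0) ∧
    ∀ j ≤ n, (ringLanczos A w v (n + 1)).wCur ⬝ᵥ (ringLanczos A w v j).vCur = 0 := by
  -- the vanishing of the next row on the columns found so far
  have next : ∀ n, (∀ k < n, IsUnit (ringLanczos A w v (k + 1)).beta) →
      (∀ i ≤ n, ∀ j ≤ n, (ringLanczos A w v i).wCur ⬝ᵥ (ringLanczos A w v j).vCur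
        = if i = j then 1 else 0) →
      ∀ j ≤ n, (ringLanczos A w v (n + 1)).wCur ⬝ᵥ (ringLanczos A w v j).vCur = 0 := by
    intro n hβ ih j hj
    rw [wCur_succ_dotProduct, ih n le_rfl j hj]
    rcases hj.eq_or_lt with rfl | hj
    · have h : (ringLanczos A w v j).wPrev ⬝ᵥ (ringLanczos A w v j).vCur = 0 := by
        cases j with
        | zero => simp [ringLanczos]
        | succ k => exact (ih k (by omega) (k + 1) le_rfl).trans (if_neg (by omega))
      rw [h]
      simp [RingLanczosState.alpha]
    · have h := dotProduct_vHat A w v j (ringLanczos A w v n).wCur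
      have h0 : (ringLanczos A w v n).wCur ⬝ᵥ (ringLanczos A w v j).vPrev = 0 := by
        cases j with
        | zero => simp [ringLanczos]
        | succ k => exact (ih n le_rfl k (by omega)).trans (if_neg (by omega))
      rw [dotProduct_vHat_eq A w v (hβ j hj), ih n le_rfl (j + 1) hj, ih n le_rfl j hj.le,
        h0, if_neg hj.ne', zero_mul, sub_zero, sub_zero] at h
      obtain ⟨k, rfl⟩ : ∃ k, n = k + 1 := ⟨n - 1, by omega⟩
      have h1 : (ringLanczos A w v (k + 1)).wPrev ⬝ᵥ (ringLanczos A w v j).vCur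
          = if k = j then 1 else 0 := ih k (by omega) j hj.le
      rw [← h, h1]
      by_cases hkj : k = j
      · subst hkj; simp
      · simp [hkj, hj.ne']
  induction n with
  | zero =>
    have h : ∀ i ≤ 0, ∀ j ≤ 0, (ringLanczos A w v i).wCur ⬝ᵥ (ringLanczos A w v j).vCur
        = if i = j then 1 else 0 := by
      intro i hi j hj
      obtain rfl : i = 0 := by omega
      obtain rfl : j = 0 := by omega
      simpa [ringLanczos] using hwv
    exact ⟨h, next 0 (by simp) h⟩
  | succ n IH =>
    obtain ⟨ih, ihn⟩ := IH fun k hk => hβ k (by omega)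
    have hcol : ∀ i ≤ n, (ringLanczos A w v i).wCur ⬝ᵥ (ringLanczos A w v n).vHat A = 0 := by
      intro i hi
      rw [dotProduct_vHat, ih i hi n le_rfl]
      rcases hi.eq_or_lt with rfl | hi
      · have h : (ringLanczos A w v i).wCur ⬝ᵥ (ringLanczos A w v i).vPrev = 0 := by
          cases i with
          | zero => simp [ringLanczos]
          | succ k => exact (ih (k + 1) le_rfl k (by omega)).trans (if_neg (by omega))
        rw [h]
        simp [RingLanczosState.alpha]
      · have h := wCur_succ_dotProduct A w v i (ringLanczos A w v n).vCur
        have h0 : (ringLanczos A w v i).wPrev ⬝ᵥ (ringLanczos A w v n).vCur = 0 := by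
          cases i with
          | zero => simp [ringLanczos]
          | succ k => exact (ih k (by omega) n le_rfl).trans (if_neg (by omega))
        rw [ih (i + 1) hi n le_rfl, ih i hi.le n le_rfl, h0, if_neg hi.ne, mul_zero, mul_zero,
          sub_zero, sub_zero] at h
        obtain ⟨k, rfl⟩ : ∃ k, n = k + 1 := ⟨n - 1, by omega⟩
        have h1 : (ringLanczos A w v i).wCur ⬝ᵥ (ringLanczos A w v (k + 1)).vPrev
            = if i = k then 1 else 0 := ih i hi.le k (by omega)
        rw [← h, h1, if_neg hi.ne, zero_mul]
        simp
    have h : ∀ i ≤ n + 1, ∀ j ≤ n + 1,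
        (ringLanczos A w v i).wCur ⬝ᵥ (ringLanczos A w v j).vCur = if i = j then 1 else 0 := by
      intro i hi j hj
      rcases hj.eq_or_lt with rfl | hj
      · rw [dotProduct_vCur_succ]
        rcases hi.eq_or_lt with rfl | hi
        · rw [if_pos rfl]
          exact Ring.mul_inverse_cancel _ (hβ n (by omega))
        · rw [hcol i (by omega), zero_mul, if_neg hi.ne]
      · rcases hi.eq_or_lt with rfl | hi
        · rw [ihn j (by omega), if_neg hj.ne']
        · exact ih i (by omega) j (by omega)
    exact ⟨h, next (n + 1) hβ h⟩

/-- The matrix whose rows are the first `N` left Lanczos vectors. -/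
noncomputable def lanczosRows : Matrix (Fin N) (Fin N) R :=
  Matrix.of fun i => (ringLanczos A w v i).wCur

/-- The matrix whose columns are the first `N` right Lanczos vectors. -/
noncomputable def lanczosCols : Matrix (Fin N) (Fin N) R :=
  Matrix.of fun i j => (ringLanczos A w v j).vCur i

/-- The tridiagonal matrix of the Lanczos coefficients. -/
noncomputable def lanczosTridiagonal : Matrix (Fin N) (Fin N) R :=
  Matrix.of fun i j =>
    if (i : ℕ) = j then (ringLanczos A w v i).alpha A
    else if (j : ℕ) = i + 1 then 1
    else if (i : ℕ) = j + 1 then (ringLanczos A w v i).beta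
    else 0

theorem lanczosRows_mul_lanczosCols (hwv : w ⬝ᵥ v = 1)
    (hβ : ∀ k, k + 1 < N → IsUnit (ringLanczos A w v (k + 1)).beta) :
    lanczosRows A w v * lanczosCols A w v = 1 := by
  ext i j
  have := (ringLanczos_biorthogonal A w v hwv (N - 1) fun k hk => hβ k (by omega)).1
    i (by omega) j (by omega)
  simp only [Fin.val_inj] at this
  rw [Matrix.one_apply]
  exact this

/-- A row of a tridiagonal matrix with superdiagonal `1`, times a column. -/
theorem sum_tridiagonal_mul {k : ℕ} (hk : k < N) (a b : R) (f : ℕ → R) :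
    ∑ j : Fin N, (if k = j then a else if (j : ℕ) = k + 1 then 1 else if k = j + 1 then b else 0)
        * f j
      = a * f k + (if k + 1 < N then f (k + 1) else 0) + (if 0 < k then b * f (k - 1) else 0) := by
  rw [Fin.sum_univ_eq_sum_range (fun j => (if k = j then a else if j = k + 1 then 1 else
    if k = j + 1 then b else 0) * f j) N]
  have h : ∀ j, (if k = j then a else if j = k + 1 then 1 else if k = j + 1 then b else 0) * f j
      = (if j = k then a * f k else 0) + (if j = k + 1 then f (k + 1) else 0)
        + (if j = k - 1 then (if 0 < k then b * f (k - 1) else 0) else 0) := by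
    intro j
    rcases lt_trichotomy j k with hj | rfl | hj
    · have h1 : j ≠ k + 1 := by omega
      rw [if_neg hj.ne', if_neg h1, if_neg hj.ne, if_neg h1, if_pos (by omega : 0 < k)]
      by_cases h2 : k = j + 1
      · subst h2; simp
      · rw [if_neg h2, if_neg (by omega : j ≠ k - 1)]; simp
    · have h1 : j ≠ j + 1 := by omega
      rw [if_pos rfl, if_pos rfl, if_neg h1]
      by_cases h0 : 0 < j
      · rw [if_neg (by omega : j ≠ j - 1), add_zero, add_zero]
      · simp [h0]
    · have h1 : j ≠ k - 1 := by omega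
      rw [if_neg hj.ne, if_neg hj.ne', if_neg h1]
      by_cases h2 : j = k + 1
      · subst h2; simp
      · rw [if_neg h2, if_neg h2, if_neg (by omega : k ≠ j + 1)]; simp
  have hk' : k - 1 < N := by omega
  simp only [h, Finset.sum_add_distrib, Finset.sum_ite_eq', Finset.mem_range, hk, hk', if_true]

/-- The left Lanczos vectors intertwine the matrix with the tridiagonal matrix. The recurrence
breaks off after `N` steps, because the next row is orthogonal to the `N` columns found so far. -/
theorem lanczosRows_mul (hwv : w ⬝ᵥ v = 1)
    (hβ : ∀ k, k + 1 < N → IsUnit (ringLanczos A w v (k + 1)).beta)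
    (hVW : lanczosCols A w v * lanczosRows A w v = 1) :
    lanczosRows A w v * A = lanczosTridiagonal A w v * lanczosRows A w v := by
  -- `w_N V = 0`, and `V` is invertible
  have hN : (ringLanczos A w v N).wCur = 0 := by
    rcases Nat.eq_zero_or_pos N with rfl | hpos
    · exact Subsingleton.elim _ _
    have h : (ringLanczos A w v N).wCur ᵥ* lanczosCols A w v = 0 := by
      ext j
      have := (ringLanczos_biorthogonal A w v hwv (N - 1) fun k hk => hβ k (by omega)).2
        j (by omega)
      rw [Nat.sub_add_cancel hpos] at this
      exact this
    rw [← Matrix.vecMul_one (ringLanczos A w v N).wCur, ← hVW, ← Matrix.vecMul_vecMul, h,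
      Matrix.zero_vecMul]
  ext k l
  have h1 : (ringLanczos A w v (k + 1)).wCur l = ((ringLanczos A w v k).wCur ᵥ* A) l
      - (ringLanczos A w v k).alpha A * (ringLanczos A w v k).wCur l
      - (ringLanczos A w v k).beta * (ringLanczos A w v k).wPrev l := rfl
  have h2 := sum_tridiagonal_mul k.2 ((ringLanczos A w v k).alpha A)
    (ringLanczos A w v k).beta (fun j => (ringLanczos A w v j).wCur l)
  refine Eq.trans ?_ h2.symm
  have h3 : (if (k : ℕ) + 1 < N then (ringLanczos A w v (k + 1)).wCur l else 0)
      = (ringLanczos A w v (k + 1)).wCur l := by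
    split_ifs with h
    · rfl
    · rw [show (k : ℕ) + 1 = N by omega, hN]; rfl
  have h4 : (if 0 < (k : ℕ) then (ringLanczos A w v k).beta
        * (ringLanczos A w v (k - 1)).wCur l else 0)
      = (ringLanczos A w v k).beta * (ringLanczos A w v k).wPrev l := by
    split_ifs with h
    · obtain ⟨m, hm⟩ : ∃ m, (k : ℕ) = m + 1 := ⟨k - 1, by omega⟩
      rw [hm]
      rfl
    · rw [show (k : ℕ) = 0 by omega]
      simp [ringLanczos]
  rw [h3, h4, h1]
  change ((ringLanczos A w v k).wCur ᵥ* A) l = _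
  abel

end

theorem lanczosRows_mul_mul_lanczosCols_zero [NeZero N] (A : Matrix (Fin N) (Fin N) R)
    (w v : Fin N → R) (X : Matrix (Fin N) (Fin N) R) :
    (lanczosRows A w v * X * lanczosCols A w v) 0 0 = w ⬝ᵥ (X *ᵥ v) := by
  rw [mul_assoc]
  rfl

theorem pow_eq_of_intertwine {S : Type*} [Monoid S] {a t x y : S} (hxy : x * y = 1)
    (h : x * a = t * x) (n : ℕ) : t ^ n = x * a ^ n * y := by
  have : ∀ n, t ^ n * x = x * a ^ n := by
    intro n
    induction n with
    | zero => simp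
    | succ n ih => rw [pow_succ, mul_assoc, ← h, ← mul_assoc, ih, mul_assoc, ← pow_succ]
  rw [← this, mul_assoc, hxy, mul_one]

/-- If `t = x a x⁻¹` and `r = (1 - a)⁻¹`, then `(1 - t)⁻¹ = x r x⁻¹`. -/
theorem inverse_one_sub_of_intertwine {S : Type*} [Ring S] {a t x y r : S} (hxy : x * y = 1)
    (hyx : y * x = 1) (h : x * a = t * x) (hr : r = 1 + a * r) (hr' : r = 1 + r * a) :
    IsUnit (1 - t) ∧ Ring.inverse (1 - t) = x * r * y := by
  have ht : t = x * a * y := by rw [h, mul_assoc, hxy, mul_one]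
  have h1 : (1 - t) * (x * r * y) = 1 := by
    have e : t * (x * r * y) = x * (a * r) * y := by
      rw [ht]
      calc _ = x * a * (y * x) * r * y := by simp only [mul_assoc]
        _ = _ := by rw [hyx]; simp only [mul_assoc, one_mul]
    have e' : x * r * y = 1 + x * (a * r) * y := by
      nth_rewrite 1 [hr]
      rw [mul_add, add_mul, mul_one, hxy]
    rw [sub_mul, one_mul, e, e', add_sub_cancel_right]
  have h2 : (x * r * y) * (1 - t) = 1 := by
    have e : (x * r * y) * t = x * (r * a) * y := by
      rw [ht]
      calc _ = x * r * (y * x) * a * y := by simp only [mul_assoc]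
        _ = _ := by rw [hyx]; simp only [mul_assoc, one_mul]
    have e' : x * r * y = 1 + x * (r * a) * y := by
      nth_rewrite 1 [hr']
      rw [mul_add, add_mul, mul_one, hxy]
    rw [mul_sub, mul_one, e, e', add_sub_cancel_right]
  let u : Sˣ := ⟨1 - t, x * r * y, h1, h2⟩
  exact ⟨u.isUnit, Ring.inverse_unit u⟩

end NoncommutativeLanczos

/-! ### Leading symbols of the Lanczos vectors -/

section Symbols

open Set

variable {I : Set ℝ} [I.OrdConnected] [Nontrivial I]

/-- The distribution `x` has order `m` (it is as regular as an `m`-fold integration) and its leading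
symbol is the function `g` on `I`. -/
def HasOrderSymbol (m : ℤ) (x : StarAlgebra I) (g : ℝ → ℂ) : Prop :=
  ∃ f : SmoothFn I, EqOn (f : ℝ → ℂ) g I ∧ (volterra I).HasSymbol m x f

namespace HasOrderSymbol

theorem congr {m n : ℤ} {x : StarAlgebra I} {g : ℝ → ℂ} (h : HasOrderSymbol m x g)
    (hmn : m = n) : HasOrderSymbol n x g :=
  hmn ▸ h

theorem sub {m : ℤ} {x y : StarAlgebra I} {f g : ℝ → ℂ} (hx : HasOrderSymbol m x f)
    (hy : HasOrderSymbol m y g) : HasOrderSymbol m (x - y) (fun t => f t - g t) := by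
  obtain ⟨f', hf, hx⟩ := hx
  obtain ⟨g', hg, hy⟩ := hy
  exact ⟨f' - g', fun t ht => congrArg₂ (· - ·) (hf ht) (hg ht), hx.sub hy⟩

theorem mul {m n : ℤ} {x y : StarAlgebra I} {f g : ℝ → ℂ} (hx : HasOrderSymbol m x f)
    (hy : HasOrderSymbol n y g) : HasOrderSymbol (m + n) (x * y) (fun t => f t * g t) := by
  obtain ⟨f', hf, hx⟩ := hx
  obtain ⟨g', hg, hy⟩ := hy
  exact ⟨f' * g', fun t ht => congrArg₂ (· * ·) (hf ht) (hg ht), hx.mul hy⟩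

theorem zero (m : ℤ) : HasOrderSymbol m (0 : StarAlgebra I) (fun _ => 0) :=
  ⟨0, fun _ _ => rfl, VolterraCalculus.hasSymbol_zero m⟩

theorem const (z : ℂ) : HasOrderSymbol 0 (algebraMap ℂ (StarAlgebra I) z) (fun _ => z) :=
  ⟨algebraMap ℂ _ z, fun _ _ => rfl,
    ((mulOp I).commutes z) ▸ VolterraCalculus.hasSymbol_mulOp (V := volterra I) (algebraMap ℂ _ z)⟩

theorem theta : HasOrderSymbol 1 (thetaDist I) (fun _ => 1) :=
  ⟨1, fun _ _ => rfl, VolterraCalculus.hasSymbol_Θ⟩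

theorem sum {ι : Type*} (s : Finset ι) {m : ℤ} {x : ι → StarAlgebra I} {g : ι → ℝ → ℂ}
    (h : ∀ i, HasOrderSymbol m (x i) (g i)) :
    HasOrderSymbol m (∑ i ∈ s, x i) (fun t => ∑ i ∈ s, g i t) := by
  choose f hf hx using h
  refine ⟨∑ i ∈ s, f i, fun t ht => ?_, VolterraCalculus.hasSymbol_sum _ fun i _ => hx i⟩
  rw [AddSubmonoidClass.coe_finsetSum, Finset.sum_apply]
  exact Finset.sum_congr rfl fun i _ => hf i ht

theorem dotProduct {N : ℕ} {m n : ℤ} {x y : Fin N → StarAlgebra I} {f g : ℝ → Fin N → ℂ}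
    (hx : ∀ i, HasOrderSymbol m (x i) (fun t => f t i))
    (hy : ∀ i, HasOrderSymbol n (y i) (fun t => g t i)) :
    HasOrderSymbol (m + n) (x ⬝ᵥ y) (fun t => f t ⬝ᵥ g t) :=
  .sum _ fun i => (hx i).mul (hy i)

theorem inverse {m : ℤ} {x : StarAlgebra I} {g : ℝ → ℂ} (hx : HasOrderSymbol m x g)
    (hg : ∀ t ∈ I, g t ≠ 0) :
    IsUnit x ∧ HasOrderSymbol (-m) (Ring.inverse x) (fun t => Ring.inverse (g t)) := by
  obtain ⟨f, hf, hx⟩ := hx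
  have hf0 : ∀ t ∈ I, (f : ℝ → ℂ) t ≠ 0 := fun t ht => (hf ht).symm ▸ hg t ht
  have hfs : ContDiffOn ℝ ∞ (f : ℝ → ℂ) I := f.2
  let f' : SmoothFn I := ⟨fun t => ((f : ℝ → ℂ) t)⁻¹, hfs.inv hf0⟩
  have h1 : (volterra I).mulOp (f * f') = 1 := by
    refine (mulOp_congr (g := 1) fun t ht => ?_).trans (map_one (mulOp I))
    exact mul_inv_cancel₀ (hf0 t ht)
  obtain ⟨h2, h3⟩ := hx.inverse h1
  refine ⟨h2, f', fun t ht => ?_, h3⟩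
  change ((f : ℝ → ℂ) t)⁻¹ = Ring.inverse (g t)
  rw [hf ht, Ring.inverse_eq_inv']

/-- A distribution of order `0` with symbol `0` is given by a smooth kernel. -/
theorem exists_kernel {x : StarAlgebra I} {g : ℝ → ℂ} (hx : HasOrderSymbol 0 x g)
    (hg : ∀ t ∈ I, g t = 0) : ∃ k : SmoothKernel I, k.dist = x := by
  obtain ⟨f, hf, hx⟩ := hx
  have h0 : (volterra I).mulOp f = 0 :=
    (mulOp_congr (g := 0) fun t ht => (hf ht).trans (hg t ht)).trans (map_zero (mulOp I))
  obtain ⟨z, hz⟩ := hx.mem_sepOps h0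
  exact ⟨sepKernel z, (dist_sepKernel z).trans hz⟩

/-- Inverses of operators of order `2` are third derivatives of operators of order `1`. -/
theorem exists_deltaDist_three_mul {x : StarAlgebra I} {g : ℝ → ℂ}
    (hx : HasOrderSymbol (-2) x g) : ∃ b : SmoothKernel I, deltaDist I 3 * b.dist = x := by
  obtain ⟨f, -, hf⟩ := (theta.mul (theta.mul (theta.mul hx))).congr (n := 1) (by norm_num)
  obtain ⟨b, hb⟩ := exists_kernel_of_order_one hf
  refine ⟨b, ?_⟩
  have h : ∀ z : StarAlgebra I, deltaDist I 1 * (thetaDist I * z) = z := fun z => by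
    rw [← mul_assoc, deltaDist_one_mul_thetaDist, one_mul]
  rw [hb, deltaDist_eq_pow, pow_succ, pow_two, mul_assoc, mul_assoc, h, h, h]

end HasOrderSymbol

/-- Over the complex numbers, both forms of the algorithm agree. -/
theorem lanczos_eq_ringLanczos {N : ℕ} (A : Matrix (Fin N) (Fin N) ℂ) (w v : Fin N → ℂ) (k : ℕ) :
    (lanczos A w v k).wPrev = (ringLanczos A (star w) v k).wPrev ∧
    (lanczos A w v k).wCur = (ringLanczos A (star w) v k).wCur ∧
    (lanczos A w v k).vPrev = (ringLanczos A (star w) v k).vPrev ∧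
    (lanczos A w v k).vCur = (ringLanczos A (star w) v k).vCur ∧
    (lanczos A w v k).beta = (ringLanczos A (star w) v k).beta := by
  induction k with
  | zero => exact ⟨rfl, rfl, rfl, rfl, rfl⟩
  | succ k ih =>
    obtain ⟨h1, h2, h3, h4, h5⟩ := ih
    have hv : A *ᵥ (lanczos A w v k).vCur
        - ((lanczos A w v k).wCur ⬝ᵥ (A *ᵥ (lanczos A w v k).vCur)) • (lanczos A w v k).vCur
        - (lanczos A w v k).vPrev = (ringLanczos A (star w) v k).vHat A := by
      rw [h2, h3, h4, RingLanczosState.vHat]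
      congr 2
      ext i
      exact mul_comm _ _
    simp only [lanczos, ringLanczos, hv]
    simp only [h1, h2, h4, h5]
    refine ⟨trivial, rfl, trivial, ?_, rfl⟩
    ext i
    simp only [Pi.smul_apply, smul_eq_mul, Ring.inverse_eq_inv']
    exact mul_comm _ _

variable {N : ℕ}

/-- The Lanczos algorithm for the distributions is governed by the ordinary Lanczos algorithm for
the leading symbols: the rows `w_k` have order `k`, the columns `v_k` have order `-k`, the
coefficients `β_k` have order `2`, and their symbols at `t` are the quantities of the
ordinary algorithm for the symbol of the matrix at `t`. -/
theorem hasOrderSymbol_ringLanczos {X : Matrix (Fin N) (Fin N) (StarAlgebra I)}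
    {A : ℝ → Matrix (Fin N) (Fin N) ℂ} (hX : ∀ i j, HasOrderSymbol 1 (X i j) (fun t => A t i j))
    {x y : Fin N → StarAlgebra I} {w v : Fin N → ℂ}
    (hx : ∀ i, HasOrderSymbol 0 (x i) (fun _ => w i))
    (hy : ∀ i, HasOrderSymbol 0 (y i) (fun _ => v i))
    (hβ : ∀ k, k + 1 < N → ∀ t ∈ I, (ringLanczos (A t) w v (k + 1)).beta ≠ 0)
    (k : ℕ) (hk : k < N) :
    (∀ i, HasOrderSymbol (k - 1) ((ringLanczos X x y k).wPrev i)
      (fun t => (ringLanczos (A t) w v k).wPrev i)) ∧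
    (∀ i, HasOrderSymbol k ((ringLanczos X x y k).wCur i)
      (fun t => (ringLanczos (A t) w v k).wCur i)) ∧
    (∀ i, HasOrderSymbol (1 - k) ((ringLanczos X x y k).vPrev i)
      (fun t => (ringLanczos (A t) w v k).vPrev i)) ∧
    (∀ i, HasOrderSymbol (-k) ((ringLanczos X x y k).vCur i)
      (fun t => (ringLanczos (A t) w v k).vCur i)) ∧
    HasOrderSymbol 2 (ringLanczos X x y k).beta (fun t => (ringLanczos (A t) w v k).beta) ∧
    HasOrderSymbol 1 ((ringLanczos X x y k).alpha X)
      (fun t => (ringLanczos (A t) w v k).alpha (A t)) := by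
  -- The orders of `w_k`, `X` and `v_k` sum to `k + 1 - k`.
  have halpha : ∀ k : ℕ, (∀ i, HasOrderSymbol k ((ringLanczos X x y k).wCur i)
        (fun t => (ringLanczos (A t) w v k).wCur i)) →
      (∀ i, HasOrderSymbol (-k) ((ringLanczos X x y k).vCur i)
        (fun t => (ringLanczos (A t) w v k).vCur i)) →
      HasOrderSymbol 1 ((ringLanczos X x y k).alpha X)
        (fun t => (ringLanczos (A t) w v k).alpha (A t)) := by
    intro k h1 h2
    exact (HasOrderSymbol.dotProduct h1 fun i => HasOrderSymbol.dotProduct (hX i) h2).congr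
      (by ring)
  induction k with
  | zero =>
    have h1 : ∀ i, HasOrderSymbol ((0 : ℕ) : ℤ) ((ringLanczos X x y 0).wCur i)
        (fun t => (ringLanczos (A t) w v 0).wCur i) := hx
    have h2 : ∀ i, HasOrderSymbol (-((0 : ℕ) : ℤ)) ((ringLanczos X x y 0).vCur i)
        (fun t => (ringLanczos (A t) w v 0).vCur i) := hy
    exact ⟨fun i => .zero _, h1, fun i => .zero _, h2, .zero _, halpha 0 h1 h2⟩
  | succ k ih =>
    obtain ⟨hwp, hw, hvp, hv, hb, ha⟩ := ih (by omega)
    have hw' : ∀ i, HasOrderSymbol ((k + 1 : ℕ) : ℤ) ((ringLanczos X x y (k + 1)).wCur i)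
        (fun t => (ringLanczos (A t) w v (k + 1)).wCur i) := by
      intro i
      have e1 := (HasOrderSymbol.dotProduct hw fun j => hX j i).congr
        (n := ((k + 1 : ℕ) : ℤ)) (by push_cast; ring)
      have e2 := (ha.mul (hw i)).congr (n := ((k + 1 : ℕ) : ℤ)) (by push_cast; ring)
      have e3 := (hb.mul (hwp i)).congr (n := ((k + 1 : ℕ) : ℤ)) (by push_cast; ring)
      exact (e1.sub e2).sub e3
    have hvh : ∀ i, HasOrderSymbol (1 - k) ((ringLanczos X x y k).vHat X i)
        (fun t => (ringLanczos (A t) w v k).vHat (A t) i) := by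
      intro i
      have e1 := (HasOrderSymbol.dotProduct (hX i) hv).congr (n := 1 - k) (by ring)
      have e2 := ((hv i).mul ha).congr (n := 1 - k) (by ring)
      exact (e1.sub e2).sub (hvp i)
    have hb' : HasOrderSymbol 2 (ringLanczos X x y (k + 1)).beta
        (fun t => (ringLanczos (A t) w v (k + 1)).beta) :=
      (HasOrderSymbol.dotProduct hw' hvh).congr (by push_cast; ring)
    have hv' : ∀ i, HasOrderSymbol (-((k + 1 : ℕ) : ℤ)) ((ringLanczos X x y (k + 1)).vCur i)
        (fun t => (ringLanczos (A t) w v (k + 1)).vCur i) := fun i =>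
      ((hvh i).mul (hb'.inverse (hβ k hk)).2).congr (by push_cast; ring)
    refine ⟨fun i => (hw i).congr (by push_cast; ring), hw', fun i => (hv i).congr
      (by push_cast; ring), hv', hb', halpha _ hw' hv'⟩

end Symbols

/-! ### Tridiagonalization of the time-ordered exponential -/

section Main

open MeasureTheory Set Filter Topology

open scoped TensorProduct

variable {I : Set ℝ} [I.OrdConnected] [Nontrivial I] {N : ℕ}

theorem sandwich_eq_dotProduct (w v : Fin N → ℂ) (X : Matrix (Fin N) (Fin N) (StarAlgebra I)) :
    sandwich w X v = (fun i => algebraMap ℂ (StarAlgebra I) (star (w i)))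
      ⬝ᵥ (X *ᵥ fun j => algebraMap ℂ (StarAlgebra I) (v j)) := by
  simp only [sandwich, dotProduct, Matrix.mulVec, Finset.mul_sum]
  refine Finset.sum_congr rfl fun i _ => Finset.sum_congr rfl fun j _ => ?_
  rw [Algebra.smul_def, map_mul, mul_assoc, Algebra.commutes (v j)]

theorem sandwich_apply_apply (w v : Fin N → ℂ) (X : Matrix (Fin N) (Fin N) (StarAlgebra I))
    (φ : TestSpace I) (t : ℝ) : (sandwich w X v φ : ℝ → ℂ) t
      = ∑ i, ∑ j, (star (w i) * v j) * (X i j φ : ℝ → ℂ) t := by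
  simp only [sandwich, LinearMap.sum_apply, Submodule.coe_sum, Finset.sum_apply]
  rfl

/-- If `k` is the inverse of `θ⁻¹ - b`, then `1 + b k` is the inverse of `1 - b θ`. -/
theorem eq_one_add_of_fundamental {S : Type*} [Ring S] {θ b k : S} (h1 : θ * b * k = k - θ)
    (h2 : k * b * θ = k - θ) :
    1 + b * k = 1 + b * θ * (1 + b * k) ∧ 1 + b * k = 1 + (1 + b * k) * (b * θ) ∧
      θ * (1 + b * k) = k := by
  refine ⟨?_, ?_, ?_⟩
  · have : b * θ * (1 + b * k) = b * θ + b * (θ * b * k) := by noncomm_ring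
    rw [this, h1]; noncomm_ring
  · have : (1 + b * k) * (b * θ) = b * θ + b * (k * b * θ) := by noncomm_ring
    rw [this, h2]; noncomm_ring
  · rw [mul_add, ← mul_assoc, h1]; noncomm_ring

theorem eq_one_of_idempotent {S : Type*} [Ring S] {x y : S} (hxy : x * y = 1)
    (h : ∀ e, e = 1 - y * x → e * e = e → e = 0) : y * x = 1 := by
  have := h _ rfl (by
    have : y * x * (y * x) = y * x := by
      rw [mul_assoc, ← mul_assoc x, hxy, one_mul]
    rw [sub_mul, mul_sub, mul_sub, this]; noncomm_ring)
  exact (sub_eq_zero.1 this).symm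

/-- The time-ordered exponential is `Φ(t') Φ(t)⁻¹` for a fundamental matrix `Φ`. -/
theorem IsTimeOrderedExp.eq_mul {I : Set ℝ} [I.OrdConnected] {A : ℝ → Matrix (Fin N) (Fin N) ℂ}
    {U : ℝ → ℝ → Matrix (Fin N) (Fin N) ℂ} (hU : IsTimeOrderedExp I A U)
    {Φ Ψ : ℝ → Matrix (Fin N) (Fin N) ℂ} (h1 : ∀ t ∈ I, Φ t * Ψ t = 1)
    (hΨ : ∀ t ∈ I, ∀ i j, HasDerivWithinAt (fun s => Ψ s i j) ((-(Ψ t * A t)) i j) I t)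
    {t t' : ℝ} (ht : t ∈ I) (ht' : t' ∈ I) (htt : t ≤ t') : U t' t = Φ t' * Ψ t := by
  obtain ⟨hU1, hU2⟩ := hU t ht
  -- `Ψ(s) U(s, t)` does not depend on `s`.
  have key : Ψ t' * U t' t = Ψ t := by
    ext i j
    have hconv : Convex ℝ (I ∩ Ici t) := (convex_interval I).inter (convex_Ici t)
    have hd : ∀ s ∈ I ∩ Ici t, HasDerivWithinAt (fun s => ∑ k, Ψ s i k * U s t k j) 0
        (I ∩ Ici t) s := by
      intro s hs
      refine (HasDerivWithinAt.fun_sum fun k _ => ((hΨ s hs.1 i k).mono inter_subset_left).mul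
        (hU2 s hs.1 hs.2 k j)).congr_deriv ?_
      have e : -(Ψ s * A s) * U s t + Ψ s * (A s * U s t) = 0 := by
        rw [neg_mul, Matrix.mul_assoc, neg_add_cancel]
      have := congrFun₂ e i j
      rw [Finset.sum_add_distrib]
      simpa [Matrix.mul_apply (N := U s t), Matrix.mul_apply (N := A s * U s t)] using this
    have := eqOn_const_of_hasDerivWithinAt_zero hconv hd (x := t') (y := t) ⟨ht', htt⟩
      ⟨ht, le_refl t⟩
    rw [hU1] at this
    rw [Matrix.mul_apply]
    exact this.trans (by rw [← Matrix.mul_apply, Matrix.mul_one])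
  rw [← key, ← Matrix.mul_assoc, h1 t' ht', Matrix.one_mul]

theorem matrixTheta_apply (A : ℝ → Matrix (Fin N) (Fin N) ℂ)
    (hA : ∀ i j, ContDiffOn ℝ ∞ (fun t => A t i j) I) (i j : Fin N) :
    matrixTheta A hA i j = mulOp I ⟨fun t => A t i j, hA i j⟩ * thetaDist I := by
  refine LinearMap.ext fun φ => TestSpace.ext_on fun s hs => ?_
  refine (SmoothKernel.dist_apply _ _ hs).trans ?_
  refine (integral_const_mul (A s i j) _).trans ?_
  exact congrArg (A s i j * ·) (thetaDist_apply φ hs).symm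

theorem hasOrderSymbol_matrixTheta (A : ℝ → Matrix (Fin N) (Fin N) ℂ)
    (hA : ∀ i j, ContDiffOn ℝ ∞ (fun t => A t i j) I) (i j : Fin N) :
    HasOrderSymbol 1 (matrixTheta A hA i j) (fun t => A t i j) := by
  rw [matrixTheta_apply]
  have h : HasOrderSymbol 0 (mulOp I ⟨fun t => A t i j, hA i j⟩) (fun t => A t i j) :=
    ⟨_, fun _ _ => rfl, VolterraCalculus.hasSymbol_mulOp (V := volterra I) _⟩
  simpa only [mul_one, zero_add] using h.mul .theta

/-- The Lanczos vectors of the distributions form mutually inverse matrices: `1 - V W` is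
idempotent, and its entries are Volterra operators because the symbols of `V` and `W` are
mutually inverse. -/
theorem lanczosCols_mul_lanczosRows {X : Matrix (Fin N) (Fin N) (StarAlgebra I)}
    {A : ℝ → Matrix (Fin N) (Fin N) ℂ} (hX : ∀ i j, HasOrderSymbol 1 (X i j) (fun t => A t i j))
    {x y : Fin N → StarAlgebra I} {w v : Fin N → ℂ}
    (hx : ∀ i, HasOrderSymbol 0 (x i) (fun _ => w i))
    (hy : ∀ i, HasOrderSymbol 0 (y i) (fun _ => v i)) (hwv : w ⬝ᵥ v = 1)
    (hβ : ∀ k, k + 1 < N → ∀ t ∈ I, (ringLanczos (A t) w v (k + 1)).beta ≠ 0)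
    (hWV : lanczosRows X x y * lanczosCols X x y = 1) :
    lanczosCols X x y * lanczosRows X x y = 1 := by
  have hord := hasOrderSymbol_ringLanczos hX hx hy hβ
  refine eq_one_of_idempotent (S := Matrix (Fin N) (Fin N) (StarAlgebra I)) hWV
    fun e he hee => ?_
  have hsymb : ∀ t ∈ I, lanczosCols (A t) w v * lanczosRows (A t) w v = 1 := fun t ht =>
    mul_eq_one_comm.1 (lanczosRows_mul_lanczosCols (A t) w v hwv
      fun k hk => (hβ k hk t ht).isUnit)
  have hker : ∀ i j, ∃ k : SmoothKernel I, k.dist = e i j := by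
    intro i j
    have h1 : HasOrderSymbol 0 ((1 : Matrix (Fin N) (Fin N) (StarAlgebra I)) i j)
        (fun _ => (1 : Matrix (Fin N) (Fin N) ℂ) i j) := by
      by_cases hij : i = j
      · rw [hij, Matrix.one_apply_eq, Matrix.one_apply_eq]
        exact (map_one (algebraMap ℂ (StarAlgebra I))) ▸ HasOrderSymbol.const 1
      · rw [Matrix.one_apply_ne hij, Matrix.one_apply_ne hij]
        exact .zero 0
    have h2 : HasOrderSymbol 0 ((lanczosCols X x y * lanczosRows X x y) i j)
        (fun t => (lanczosCols (A t) w v * lanczosRows (A t) w v) i j) := by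
      have h : ∀ k : Fin N, HasOrderSymbol 0 (lanczosCols X x y i k * lanczosRows X x y k j)
          (fun t => lanczosCols (A t) w v i k * lanczosRows (A t) w v k j) := fun k =>
        (((hord k k.2).2.2.2.1 i).mul ((hord k k.2).2.1 j)).congr (by ring)
      simp only [Matrix.mul_apply]
      exact .sum _ h
    rw [he]
    refine (h1.sub h2).exists_kernel fun t ht => ?_
    rw [hsymb t ht, sub_self]
  choose F hF using hker
  have heF : distMatrix F = e := by
    ext1 i j
    exact hF i j
  rw [← heF] at hee ⊢
  exact distMatrix_eq_zero_of_idempotent F hee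

/-- The resolvent `r` of `Ã(t') Θ` exists, and `Θ * r` is the distribution with the kernel
`U(t', t) Θ(t' - t)`: for a fundamental matrix `Φ`, it is the operator `Φ Θ Φ⁻¹`. -/
theorem exists_resolvent (A : ℝ → Matrix (Fin N) (Fin N) ℂ)
    (hA : ∀ i j, ContDiffOn ℝ ∞ (fun t => A t i j) I)
    (U : ℝ → ℝ → Matrix (Fin N) (Fin N) ℂ) (hU : IsTimeOrderedExp I A U) :
    ∃ r : Matrix (Fin N) (Fin N) (StarAlgebra I),
      r = 1 + matrixTheta A hA * r ∧ r = 1 + r * matrixTheta A hA ∧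
      ∃ z : Fin N → Fin N → SmoothFn I ⊗[ℂ] SmoothFn I,
        (∀ i j, thetaDist I * r i j = (volterra I).sep (z i j)) ∧
        ∀ t ∈ I, ∀ t' ∈ I, t ≤ t' → ∀ i j, evalKernel I t' t (z i j) = U t' t i j := by
  let B : Matrix (Fin N) (Fin N) (SmoothFn I) := Matrix.of fun i j => ⟨fun t => A t i j, hA i j⟩
  obtain ⟨Φ, Ψ, h1, h2, h3⟩ := exists_fundamental_matrix B
  obtain ⟨k1, k2, k3⟩ := map_mulOp_fundamental h1 h2 h3
  obtain ⟨l1, l2⟩ := VolterraCalculus.fundamental_resolvent (V := volterra I) k1 k2 k3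
  obtain ⟨m1, m2, m3⟩ := eq_one_add_of_fundamental
    (S := Matrix (Fin N) (Fin N) (StarAlgebra I)) l1 l2
  have hX : matrixTheta A hA
      = B.map (volterra I).mulOp * Matrix.diagonal (fun _ => (volterra I).Θ) := by
    ext1 i j
    rw [Matrix.mul_diagonal]
    exact matrixTheta_apply A hA i j
  rw [← hX] at m1 m2
  refine ⟨_, m1, m2, fun i j => ∑ k, Φ i k ⊗ₜ Ψ k j, fun i j => ?_, ?_⟩
  · have := congrFun₂ m3 i j
    rw [Matrix.diagonal_mul] at this
    refine this.trans ?_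
    rw [Matrix.mul_apply, map_sum]
    refine Finset.sum_congr rfl fun k _ => ?_
    rw [Matrix.mul_diagonal, VolterraCalculus.sep_tmul]
    rfl
  · intro t ht t' ht' htt i j
    rw [hU.eq_mul (Φ := fun t => Matrix.of fun i j => (Φ i j : ℝ → ℂ) t)
      (Ψ := fun t => Matrix.of fun i j => (Ψ i j : ℝ → ℂ) t) ?_ ?_ ht ht' htt]
    · simp [Matrix.mul_apply]
    · intro t ht
      ext i j
      simpa [Matrix.mul_apply, Matrix.one_apply] using h1 t ht i j
    · intro t ht i j
      refine (h3 t ht i j).congr_deriv ?_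
      simp [Matrix.mul_apply, B]

end Main

theorem mainTheorem1 (I : Set ℝ) [I.OrdConnected] [Nontrivial I] {N : ℕ} [NeZero N]
    (A : ℝ → Matrix (Fin N) (Fin N) ℂ) (hA : ∀ i j, ContDiffOn ℝ ∞ (fun t => A t i j) I)
    (U : ℝ → ℝ → Matrix (Fin N) (Fin N) ℂ) (hU : IsTimeOrderedExp I A U)
    (w v : Fin N → ℂ) (hwv : star w ⬝ᵥ v = 1)
    (hL : ∀ t ∈ I, ∀ k, 1 ≤ k → k ≤ N - 1 → ¬ LanczosBreakdown (A t) w v k) :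
    ∃ α β : ℕ → SmoothKernel I,
      (∀ i, 1 ≤ i → i ≤ N - 1 →
        (∀ t ∈ I, β i t t = 0) ∧
        (∃ t ∈ I, derivWithin (fun s => β i s t) I t ≠ 0) ∧
        (∃ t ∈ I, derivWithin (fun s => β i t s) I t ≠ 0)) ∧
      (∀ n : ℕ, sandwich w (matrixTheta A hA ^ n) v = (tridiagonal N α β ^ n) 0 0) ∧
      IsUnit (1 - tridiagonal N α β) ∧
      (∀ (φ : TestSpace I) (t : ℝ), HasSum
        (fun n : ℕ => ((tridiagonal N α β ^ n) 0 0 φ : ℝ → ℂ) t)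
        ((starResolvent (tridiagonal N α β) 0 0 φ : ℝ → ℂ) t)) ∧
      (∃ u : SmoothKernel I,
        (∀ t ∈ I, ∀ t' ∈ I, t ≤ t' → u t' t = star w ⬝ᵥ (U t' t *ᵥ v)) ∧
        u.dist = thetaDist I * starResolvent (tridiagonal N α β) 0 0) ∧
      (∀ i, 1 ≤ i → i ≤ N - 1 → ∃ b : SmoothKernel I,
        (deltaDist I 3 * b.dist) * (β i).dist = 1 ∧
        (β i).dist * (deltaDist I 3 * b.dist) = 1) := by
  -- the Lanczos algorithm in the noncommutative ring of distributions, with inputs `X`, `x`, `y`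
  let X : Matrix (Fin N) (Fin N) (StarAlgebra I) := matrixTheta A hA
  let x : Fin N → StarAlgebra I := fun i => algebraMap ℂ _ (star (w i))
  let y : Fin N → StarAlgebra I := fun i => algebraMap ℂ _ (v i)
  have hb0 : ∀ k, k + 1 < N → ∀ t ∈ I, (ringLanczos (A t) (star w) v (k + 1)).beta ≠ 0 := by
    intro k hk t ht
    have := hL t ht (k + 1) (by omega) (by omega)
    rwa [LanczosBreakdown, (lanczos_eq_ringLanczos _ _ _ _).2.2.2.2] at this
  obtain ⟨r, hr1, hr2, z, hz1, hz2⟩ := exists_resolvent A hA U hU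
  have hX : ∀ i j, HasOrderSymbol 1 (X i j) (fun t => A t i j) :=
    hasOrderSymbol_matrixTheta A hA
  have hord := hasOrderSymbol_ringLanczos hX (x := x) (y := y) (w := star w) (v := v)
    (fun i => .const _) (fun i => .const _) hb0
  have hxy : x ⬝ᵥ y = 1 := by
    have : x ⬝ᵥ y = algebraMap ℂ (StarAlgebra I) (star w ⬝ᵥ v) := by
      simp [dotProduct, x, y, map_sum]
    rw [this, hwv, map_one]
  have hβ : ∀ k, k + 1 < N → IsUnit (ringLanczos X x y (k + 1)).beta := fun k hk =>
    ((hord (k + 1) hk).2.2.2.2.1.inverse (hb0 k hk)).1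
  have hWV := lanczosRows_mul_lanczosCols X x y hxy hβ
  have hVW : lanczosCols X x y * lanczosRows X x y = 1 :=
    lanczosCols_mul_lanczosRows hX (fun i => .const _) (fun i => .const _) hwv hb0 hWV
  have hint := lanczosRows_mul X x y hxy hβ hVW
  -- `α_k` has order `1` and `β_k` has order `2`, so they have smooth kernels.
  have hα : ∀ k, ∃ f : SmoothKernel I, k < N → f.dist = (ringLanczos X x y k).alpha X := by
    intro k
    by_cases hk : k < N
    · obtain ⟨g, -, hg⟩ := (hord k hk).2.2.2.2.2
      obtain ⟨f, hf⟩ := exists_kernel_of_order_one hg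
      exact ⟨f, fun _ => hf⟩
    · exact ⟨sepKernel 0, fun h => absurd h hk⟩
  have hβ' : ∀ k, ∃ f : SmoothKernel I, k + 1 < N →
      f.dist = (ringLanczos X x y (k + 1)).beta ∧ ∀ t ∈ I,
        f t t = 0 ∧ derivWithin (fun s => f s t) I t ≠ 0 ∧
        derivWithin (fun s => f t s) I t ≠ 0 := by
    intro k
    by_cases hk : k + 1 < N
    · obtain ⟨g, hg', hg⟩ := (hord (k + 1) hk).2.2.2.2.1
      obtain ⟨f, hf, hf'⟩ := exists_kernel_of_order_two hg
      refine ⟨f, fun _ => ⟨hf, fun t ht => ?_⟩⟩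
      obtain ⟨e1, e2, e3⟩ := hf' t ht
      have := hb0 k hk t ht
      rw [e2, e3, hg' ht]
      exact ⟨e1, this, neg_ne_zero.2 this⟩
    · exact ⟨sepKernel 0, fun h => absurd h hk⟩
  choose α hα using hα
  choose β hβ' using hβ'
  -- `β` is indexed from `0` here, so that `β_k` is `β (k - 1)`.
  have hT : tridiagonal N α (fun k => β (k - 1)) = lanczosTridiagonal X x y := by
    ext1 i j
    simp only [tridiagonal, lanczosTridiagonal, Matrix.of_apply, deltaDist_zero]
    rw [hα i i.2]
    by_cases hij : (i : ℕ) = j + 1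
    · rw [hij, Nat.add_sub_cancel, (hβ' j (by omega)).1]
    · rw [if_neg hij, if_neg hij]
  obtain ⟨t0, ht0⟩ : I.Nonempty := ⟨_, basePoint_mem I⟩
  obtain ⟨hU1, hU2⟩ := inverse_one_sub_of_intertwine
    (S := Matrix (Fin N) (Fin N) (StarAlgebra I)) hWV hVW hint hr1 hr2
  have hpow : ∀ n, sandwich w (X ^ n) v = (lanczosTridiagonal X x y ^ n) 0 0 := by
    intro n
    rw [pow_eq_of_intertwine hWV hint, sandwich_eq_dotProduct]
    exact (lanczosRows_mul_mul_lanczosCols_zero X x y (X ^ n)).symm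
  have hres : starResolvent (lanczosTridiagonal X x y) 0 0 = sandwich w r v := by
    rw [sandwich_eq_dotProduct]
    refine Eq.trans ?_ (lanczosRows_mul_mul_lanczosCols_zero X x y r)
    exact congrFun₂ hU2 0 0
  refine ⟨α, fun k => β (k - 1), ?_, ?_⟩
  · intro i h1 h2
    obtain ⟨k, rfl⟩ : ∃ k, i = k + 1 := ⟨i - 1, by omega⟩
    have h := (hβ' k (by omega)).2
    exact ⟨fun t ht => (h t ht).1, ⟨t0, ht0, (h t0 ht0).2.1⟩, ⟨t0, ht0, (h t0 ht0).2.2⟩⟩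
  rw [hT]
  refine ⟨hpow, hU1, ?_, ?_, ?_⟩
  · intro φ t
    rw [hres]
    simp only [← hpow, sandwich_apply_apply]
    exact hasSum_sum fun i _ => hasSum_sum fun j _ => (hasSum_distMatrix_pow
      (fun i j => ⟨fun s _ => A s i j, (hA i j).comp contDiffOn_fst fun _ hp => hp.1⟩)
      hr1 φ t i j).mul_left _
  · refine ⟨sepKernel (∑ i, ∑ j, (star (w i) * v j) • z i j), ?_, ?_⟩
    · intro t ht t' ht' htt
      change evalKernel I t' t _ = _
      simp only [map_sum, map_smul, hz2 t ht t' ht' htt, dotProduct, Matrix.mulVec,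
        Finset.mul_sum, smul_eq_mul]
      refine Finset.sum_congr rfl fun i _ => Finset.sum_congr rfl fun j _ => ?_
      rw [Pi.star_apply]
      ring
    · rw [hres, dist_sepKernel, sandwich]
      simp only [map_sum, map_smul, Finset.mul_sum, mul_smul_comm, hz1]
  · intro i h1 h2
    obtain ⟨k, rfl⟩ : ∃ k, i = k + 1 := ⟨i - 1, by omega⟩
    simp only [Nat.add_sub_cancel]
    rw [(hβ' k (by omega)).1]
    obtain ⟨hu, hinv⟩ := (hord (k + 1) (by omega)).2.2.2.2.1.inverse (hb0 k (by omega))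
    obtain ⟨b, hb⟩ := hinv.exists_deltaDist_three_mul
    refine ⟨b, ?_, ?_⟩
    · rw [hb, Ring.inverse_mul_cancel _ hu]
    · rw [hb, Ring.mul_inverse_cancel _ hu]
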